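/- **Setting.** Fix $d$ and $\beta^\star\in\mathbb R^d$. Let $X_1,X_2,\dots$ be i.i.d. random vectors in $\mathbb R^d$ with mean zero and positive definite covariance matrix $\Sigma_X$, independent of the i.i.d. real errors $\epsilon_1,\epsilon_2,\dots$ with mean zero and variance $\sigma^2$. For each $n$ let $$Y_i=\mu_i^\star+X_i^T\beta^\star+\epsilon_i,\qquad 1\le i\le n,$$ where the deterministic incidental parameters $\mu_i^\star$ may depend on $n$. For sequences, $a_n\ll b_n$ (or $b_n\gg a_n$) means $a_n=o(b_n)$, and $a_n\sim b_n$ means asymptotic equivalence. Assume: - $\kappa_n,\gamma_n>0$ satisfy $\kappa_n,\gamma_n\ll\sqrt n$, $P(\max_{i\le n}\|X_i\|_2>\kappa_n)\to0$ and $P(\max_{i\le n}|\epsilon_i|>\gamma_n)\to0$. - With $s_1=s_1(n)$, $s_2=s_2(n)$, $s_1+s_2\le n$, $s_1,s_2\to\infty$ and $s_1,s_2\ll n$: $\mu^\star:=\min_{1\le i\le s_1}|\mu_i^\star|\gg\max\{\kappa_n,\gamma_n\}$; $0<|\mu_i^\star|\le\gamma_n$ for $s_1<i\le s_1+s_2$;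 and $\mu_i^\star=0$ for $s_1+s_2<i\le n$. - The regularization parameter $\lambda=\lambda_n$ satisfies $\kappa_n\ll\lambda$, $\alpha\gamma_n\le\lambda$ for some constant $\alpha>2$, and $\lambda\ll\min\{\mu^\star,\sqrt n\}$. - Assumption (A): for some $\delta>0$, $\mathbb E\|X_1\|_2^{2+\delta}<\infty$ and $\|\mu_2^\star\|_2/\|\mu_2^\star\|_{2+\delta}\to\infty$, where $\mu_2^\star=(\mu_i^\star)_{s_1<i\le s_1+s_2}$. Let $D_n=\|\mu_2^\star\|_2$. Let the one-step estimator $\hat\beta_n$ be any sequence of random vectors such that, with probability tending to one, $\hat\beta_n$ is the $\beta$-component of a global minimizer over $(\mu,\beta)\in\mathbb R^n\times\mathbb R^d$ of $$\sum_{i=1}^n(Y_i-\mu_i-X_i^T\beta)^2+\sum_{i=1}^n2\lambda|\mu_i|.$$ **Theorem.** For all constants $b,c>0$ the following hold, where $r_n$ denotes any sequence with the stated asymptotics. 1. If $s_1\ll n/\lambda^2$ and $D_n^2/n=o(1)$, then $\sqrt n(\hat\beta_n-\beta^\star)\xrightarrow{d}N(0,\sigma^2\Sigma_X^{-1})$.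 2. If $s_1\ll n/\lambda^2$ and $D_n^2/n\sim c$, then $\sqrt n(\hat\beta_n-\beta^\star)\xrightarrow{d}N(0,(c+\sigma^2)\Sigma_X^{-1})$. 3. If $s_1\ll n/\lambda^2$, $D_n^2/n\to\infty$ and $r_n\sim n/D_n$, then $r_n\ll\sqrt n$ and $r_n(\hat\beta_n-\beta^\star)\xrightarrow{d}N(0,\Sigma_X^{-1})$. 4. If $s_1\sim bn/\lambda^2$ and $D_n^2/n=o(1)$, then $\sqrt n(\hat\beta_n-\beta^\star)\xrightarrow{d}N(0,(b+\sigma^2)\Sigma_X^{-1})$. 5. If $s_1\sim bn/\lambda^2$ and $D_n^2/n\sim c$, then $\sqrt n(\hat\beta_n-\beta^\star)\xrightarrow{d}N(0,(b+c+\sigma^2)\Sigma_X^{-1})$. 6. If $s_1\sim bn/\lambda^2$, $D_n^2/n\to\infty$ and $r_n\sim n/D_n$, then $r_n\ll\sqrt n$ and $r_n(\hat\beta_n-\beta^\star)\xrightarrow{d}N(0,\Sigma_X^{-1})$. 7. If $s_1\gg n/\lambda^2$, either $D_n^2/n=o(1)$ or $D_n^2/n\sim c$, and $r_n\sim n/(\lambda\sqrt{s_1})$,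 then $r_n\ll\sqrt n$ and $r_n(\hat\beta_n-\beta^\star)\xrightarrow{d}N(0,\Sigma_X^{-1})$. 8. If $s_1\gg n/\lambda^2$, $D_n^2/n\to\infty$ and $r_n\sim\min\{\sqrt b\,n/(\lambda\sqrt{s_1}),\,n/D_n\}$, then $r_n\ll\sqrt n$, and - (8a) if $\sqrt b\,n/(\lambda\sqrt{s_1})\gg n/D_n$, then $r_n(\hat\beta_n-\beta^\star)\xrightarrow{d}N(0,\Sigma_X^{-1})$; - (8b) if $\sqrt b\,n/(\lambda\sqrt{s_1})\sim n/D_n$, then $r_n(\hat\beta_n-\beta^\star)\xrightarrow{d}N(0,(1+b)\Sigma_X^{-1})$; - (8c) if $\sqrt b\,n/(\lambda\sqrt{s_1})\ll n/D_n$, then $r_n(\hat\beta_n-\beta^\star)\xrightarrow{d}N(0,b\Sigma_X^{-1})$. -/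

import Mathlib

open MeasureTheory ProbabilityTheory Filter Asymptotics
open scoped Topology

namespace IncidentalRegression

/-- The column space `ℝᵈ` with its Euclidean norm. -/
abbrev Vec (d : ℕ) : Type := EuclideanSpace ℝ (Fin d)

/-- The soft (`L₁`, LASSO) penalty `p_λ(t) = 2 λ t`, evaluated at `t = |μᵢ|`. -/
def softPenalty (lam t : ℝ) : ℝ := 2 * lam * t

/-- The penalized least-squares loss
`L(μ, β) = ∑ᵢ (yᵢ - μᵢ - xᵢᵀ β)² + ∑ᵢ p_λ(|μᵢ|)` for `n` data points `(xᵢ, yᵢ)`. -/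
noncomputable def penalizedLoss {d n : ℕ} (lam : ℝ) (x : Fin n → Vec d) (y : Fin n → ℝ)
    (m : Fin n → ℝ) (β : Vec d) : ℝ :=
  ∑ i, (y i - m i - inner ℝ (x i) β) ^ 2 + ∑ i, softPenalty lam |m i|

/-- `β` is the `β`-component of a global minimizer `(m, β)` of the penalized loss. -/
def IsPenalizedEstimate {d n : ℕ} (lam : ℝ) (x : Fin n → Vec d) (y : Fin n → ℝ)
    (β : Vec d) : Prop :=
  ∃ m : Fin n → ℝ, ∀ (m' : Fin n → ℝ) (β' : Vec d),
    penalizedLoss lam x y m β ≤ penalizedLoss lam x y m' β'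

/-- The covariance matrix of a random vector. -/
noncomputable def covMatrix {Ω : Type*} [MeasurableSpace Ω] (P : Measure Ω) {d : ℕ}
    (Z : Ω → Vec d) : Matrix (Fin d) (Fin d) ℝ :=
  Matrix.of fun j k => covariance (fun ω => Z ω j) (fun ω => Z ω k) P

/-- Random part of the model: the covariates are i.i.d., centred, with positive definite
covariance matrix; the errors are i.i.d., centred, with variance `σ²`; the two sequences are
independent.  Observations are numbered `0, 1, 2, …`. -/
structure RandomDesign {Ω : Type*} [MeasurableSpace Ω] (P : Measure Ω) {d : ℕ}
    (X : ℕ → Ω → Vec d) (ε : ℕ → Ω → ℝ) (σ : ℝ) : Prop where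
  measurable_X : ∀ i, Measurable (X i)
  measurable_ε : ∀ i, Measurable (ε i)
  indep_X : iIndepFun X P
  indep_ε : iIndepFun ε P
  indep_X_ε : IndepFun (fun ω i => X i ω) (fun ω i => ε i ω) P
  ident_X : ∀ i, IdentDistrib (X i) (X 0) P P
  ident_ε : ∀ i, IdentDistrib (ε i) (ε 0) P P
  memLp_X : MemLp (X 0) 2 P
  memLp_ε : MemLp (ε 0) 2 P
  mean_X : ∫ ω, X 0 ω ∂P = 0
  mean_ε : ∫ ω, ε 0 ω ∂P = 0
  posDef_X : (covMatrix P (X 0)).PosDef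
  var_ε : variance (ε 0) P = σ ^ 2

/-- `κ` and `γ` are positive sequences of order smaller than `√n` that bound, with probability
tending to one, the largest covariate norm and the largest error among the first `n`. -/
structure MaximalBounds {Ω : Type*} [MeasurableSpace Ω] (P : Measure Ω) {d : ℕ}
    (X : ℕ → Ω → Vec d) (ε : ℕ → Ω → ℝ) (κ γ : ℕ → ℝ) : Prop where
  κ_pos : ∀ n, 0 < κ n
  γ_pos : ∀ n, 0 < γ n
  κ_small : κ =o[atTop] fun n : ℕ => √(n : ℝ)
  γ_small : γ =o[atTop] fun n : ℕ => √(n : ℝ)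
  max_X : Tendsto (fun n : ℕ => P {ω | ∃ i < n, κ n < ‖X i ω‖}) atTop (𝓝 0)
  max_ε : Tendsto (fun n : ℕ => P {ω | ∃ i < n, γ n < |ε i ω|}) atTop (𝓝 0)

/-- The smallest absolute value among the first `s` entries of `m` (a minimum when `s > 0`). -/
noncomputable def minAbs (s : ℕ) (m : ℕ → ℝ) : ℝ := ⨅ i : Fin s, |m i|

/-- The three kinds of incidental parameters at sample size `n`: the entries `mu n i` with
`i < s₁ n` are large, those with `s₁ n ≤ i < s₁ n + s₂ n` are nonzero and bounded by `γ n`, and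
the remaining ones with `i < n` are zero. -/
structure SparseIncidental (mu : ℕ → ℕ → ℝ) (s₁ s₂ : ℕ → ℕ) (κ γ : ℕ → ℝ) : Prop where
  card_le : ∀ n, s₁ n + s₂ n ≤ n
  s₁_tendsto : Tendsto s₁ atTop atTop
  s₂_tendsto : Tendsto s₂ atTop atTop
  s₁_small : (fun n : ℕ => (s₁ n : ℝ)) =o[atTop] fun n : ℕ => (n : ℝ)
  s₂_small : (fun n : ℕ => (s₂ n : ℝ)) =o[atTop] fun n : ℕ => (n : ℝ)
  large : (fun n : ℕ => max (κ n) (γ n)) =o[atTop] fun n : ℕ => minAbs (s₁ n) (mu n)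
  bounded : ∀ n i, s₁ n ≤ i → i < s₁ n + s₂ n → mu n i ≠ 0 ∧ |mu n i| ≤ γ n
  zero : ∀ n i, s₁ n + s₂ n ≤ i → i < n → mu n i = 0

/-- Specification of the regularization parameter:
`κ ≪ λ`, `α γ ≤ λ` for a constant `α > 2`, and `λ ≪ min {μ⋆, √n}`, where `μ⋆` is the smallest
absolute value of the large incidental parameters. -/
structure RegularizationSpec (mu : ℕ → ℕ → ℝ) (s₁ : ℕ → ℕ) (κ γ lam : ℕ → ℝ) : Prop where
  κ_small : κ =o[atTop] lam
  γ_le : ∃ α : ℝ, 2 < α ∧ ∀ n, α * γ n ≤ lam n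
  lam_small : lam =o[atTop] fun n : ℕ => min (minAbs (s₁ n) (mu n)) √(n : ℝ)

/-- The Euclidean norm of the block of bounded incidental parameters, `D_n = ‖μ₂⋆‖₂`. -/
noncomputable def boundedNorm (mu : ℕ → ℕ → ℝ) (s₁ s₂ : ℕ → ℕ) (n : ℕ) : ℝ :=
  √(∑ i ∈ Finset.Ico (s₁ n) (s₁ n + s₂ n), mu n i ^ 2)

/-- The `ℓᵖ` norm of the block of bounded incidental parameters, `‖μ₂⋆‖_p`. -/
noncomputable def boundedLpNorm (p : ℝ) (mu : ℕ → ℕ → ℝ) (s₁ s₂ : ℕ → ℕ) (n : ℕ) : ℝ :=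
  (∑ i ∈ Finset.Ico (s₁ n) (s₁ n + s₂ n), |mu n i| ^ p) ^ (1 / p)

/-- The moment assumption: for some `δ > 0`, `E ‖X₀‖^(2+δ) < ∞` and
`‖μ₂⋆‖₂ / ‖μ₂⋆‖_{2+δ} → ∞`. -/
def MomentAssumption {Ω : Type*} [MeasurableSpace Ω] (P : Measure Ω) {d : ℕ}
    (X : ℕ → Ω → Vec d) (mu : ℕ → ℕ → ℝ) (s₁ s₂ : ℕ → ℕ) : Prop :=
  ∃ δ : ℝ, 0 < δ ∧ Integrable (fun ω => ‖X 0 ω‖ ^ (2 + δ)) P ∧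
    Tendsto (fun n => boundedNorm mu s₁ s₂ n / boundedLpNorm (2 + δ) mu s₁ s₂ n) atTop atTop

/-- The response `Yᵢ = μᵢ⋆ + Xᵢᵀ β⋆ + εᵢ`, `i < n`, at sample size `n`. -/
noncomputable def response {Ω : Type*} {d : ℕ} (X : ℕ → Ω → Vec d) (ε : ℕ → Ω → ℝ)
    (mu : ℕ → ℕ → ℝ) (βstar : Vec d) (n : ℕ) (ω : Ω) (i : Fin n) : ℝ :=
  mu n i + inner ℝ (X i ω) βstar + ε i ω

/-- `βhat n` is, for each sample size, a random vector which, with probability tending to one as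
`n → ∞`, is the `β`-component of a minimizer of the penalized least-squares loss. -/
structure IsOneStepEstimator {Ω : Type*} [MeasurableSpace Ω] (P : Measure Ω) {d : ℕ}
    (X : ℕ → Ω → Vec d) (ε : ℕ → Ω → ℝ) (mu : ℕ → ℕ → ℝ) (βstar : Vec d) (lam : ℕ → ℝ)
    (βhat : ℕ → Ω → Vec d) : Prop where
  aemeasurable : ∀ n, AEMeasurable (βhat n) P
  minimizes : Tendsto (fun n : ℕ => P {ω | ¬ IsPenalizedEstimate (lam n)
    (fun i : Fin n => X i ω) (response X ε mu βstar n ω) (βhat n ω)}) atTop (𝓝 0)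

/-- `r_n (βhat_n - β⋆)` converges in distribution to the centred Gaussian law with covariance
matrix `S`. -/
def ScaledErrorTendsto {Ω : Type*} [MeasurableSpace Ω] (P : Measure Ω) [IsProbabilityMeasure P]
    {d : ℕ} (r : ℕ → ℝ) (βhat : ℕ → Ω → Vec d) (βstar : Vec d)
    (S : Matrix (Fin d) (Fin d) ℝ) : Prop :=
  TendstoInDistribution (fun n ω => r n • (βhat n ω - βstar)) atTop
    (fun z : Vec d => z) (fun _ => P) (multivariateGaussian (0 : Vec d) S)

end IncidentalRegression

/-! For fixed `β` the minimization over `μ` is soft thresholding, so at a minimizer the residuals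
are clipped at `±lam`. If the clipped indices are exactly those of the large incidental parameters,
the stationarity condition in `β` becomes linear: `A (β - βstar) = score`, where `A` is the
normalized Gram operator of the unclipped observations and `score` is `1/n` times a sum in which `X
i` has weight `lam * sign (mu i)` on the large block and `mu i + ε i` elsewhere.

This clipping pattern is verified rather than assumed. With probability tending to one, the solution
of the linear equation lies within distance one of `βstar`. The gaps between `κ`, `γ`, `lam` and the
large parameters then make it satisfy the KKT conditions, and strict inequality on a spanning set of
covariates makes the `β`-component unique (`IsPenalizedEstimate.eq_of_certificate`,
`gramOperator_estimate_eq`).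

Probability enters in two ways. The law of large numbers sends `A` to the covariance operator,
because only `s₁ = o(n)` terms are discarded. A characteristic-function argument
(`RandomDesign.tendsto_charFun_weighted`) makes the score Gaussian. Only two laws occur there, that
of `X` and that of `ε X`, so it is enough that the weights are uniformly small, and this follows
from `lam = o(√n)` and `r = O(√n)`. The errors on the bounded block have negligible variance and are
dropped first.

The unnormalized score has variance factor `V = lam² s₁ + D² + σ² n`. Any rate `r = O(√n)` with
`(r/n)² V → τ` yields the limit `N(0, τ Σ⁻¹)` (`scaledErrorTendsto_of_rate`). The eight cases then
only ask which terms of `V` dominate. -/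

namespace IncidentalRegression

/-! ### Convex optimality: certificates that identify the penalized estimate -/

/-- A Karush–Kuhn–Tucker certificate `(m₀, β₀)` whose strictly feasible covariates span the space
determines the `β`-component of every minimizer of the penalized loss. -/
theorem IsPenalizedEstimate.eq_of_certificate {d n : ℕ} {lam : ℝ} {x : Fin n → Vec d}
    {y : Fin n → ℝ} {β : Vec d} (hβ : IsPenalizedEstimate lam x y β)
    (β₀ : Vec d) (m₀ e : Fin n → ℝ) (he : ∀ i, y i - m₀ i - inner ℝ (x i) β₀ = e i)
    (hle : ∀ i, |e i| ≤ lam) (hm : ∀ i, e i * m₀ i = lam * |m₀ i|)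
    (hgrad : ∑ i, e i • x i = 0)
    (hspan : ∀ v, (∀ i, |e i| < lam → inner ℝ (x i) v = 0) → v = 0) : β = β₀ := by
  obtain ⟨m, hm_min⟩ := hβ
  have hmin := hm_min m₀ β₀
  set Δ : Fin n → ℝ := fun i => (m i - m₀ i) + inner ℝ (x i) (β - β₀) with hΔ
  have hsum : ∑ i, e i * inner ℝ (x i) (β - β₀) = 0 := by
    have := congrArg (fun w => inner ℝ w (β - β₀)) hgrad
    simpa [sum_inner, inner_smul_left] using this
  have hgap : ∀ i, 0 ≤ lam * |m i| - e i * m i := fun i => by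
    have h1 : e i * m i ≤ |e i| * |m i| := by rw [← abs_mul]; exact le_abs_self _
    have h2 := mul_le_mul_of_nonneg_right (hle i) (abs_nonneg (m i))
    linarith
  -- The loss is expanded exactly around the certificate. The term linear in `β - β₀` cancels by
  -- `hgrad`, leaving squares plus twice the nonnegative gaps `lam |m i| - e i * m i`. Minimality of
  -- `(m, β)` makes this sum nonpositive, hence every summand zero.
  have hloss : penalizedLoss lam x y m β - penalizedLoss lam x y m₀ β₀ =
      ∑ i, (Δ i ^ 2 + 2 * (lam * |m i| - e i * m i)) := by
    have key : ∀ i, ((y i - m i - inner ℝ (x i) β) ^ 2 + softPenalty lam |m i|) -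
        ((y i - m₀ i - inner ℝ (x i) β₀) ^ 2 + softPenalty lam |m₀ i|) =
        (Δ i ^ 2 + 2 * (lam * |m i| - e i * m i)) - 2 * (e i * inner ℝ (x i) (β - β₀)) := by
      intro i
      have h1 := he i
      have h2 := hm i
      have h3 : inner ℝ (x i) (β - β₀) = inner ℝ (x i) β - inner ℝ (x i) β₀ := inner_sub_right _ _ _
      simp only [hΔ, softPenalty, h3]
      rw [← h1] at h2 ⊢
      linear_combination 2 * h2
    unfold penalizedLoss
    rw [← Finset.sum_add_distrib, ← Finset.sum_add_distrib, ← Finset.sum_sub_distrib,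
      Finset.sum_congr rfl fun i _ => key i, Finset.sum_sub_distrib, ← Finset.mul_sum, hsum]
    simp
  have hnn : ∀ i ∈ Finset.univ, 0 ≤ Δ i ^ 2 + 2 * (lam * |m i| - e i * m i) := fun i _ => by
    have := hgap i
    positivity
  have hzero := (Finset.sum_eq_zero_iff_of_nonneg hnn).1
    (le_antisymm (by linarith) (Finset.sum_nonneg hnn))
  refine sub_eq_zero.1 (hspan _ fun i hi => ?_)
  have h0 := hzero i (Finset.mem_univ i)
  have hΔ0 : Δ i = 0 := by
    have := hgap i
    exact pow_eq_zero_iff (two_ne_zero) |>.1 (le_antisymm (by linarith) (sq_nonneg _))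
  have hg0 : lam * |m i| = e i * m i := by nlinarith [sq_nonneg (Δ i), hgap i]
  -- Where `|e i| < lam`, a vanishing gap forces the incidental coordinate to vanish. It does so for
  -- both minimizers, and `Δ i = 0` then reduces to orthogonality of `x i` and `β - β₀`.
  have aux : ∀ t : ℝ, lam * |t| = e i * t → t = 0 := by
    intro t ht
    by_contra hne
    have hpos := abs_pos.2 hne
    have h1 : e i * t ≤ |e i| * |t| := by rw [← abs_mul]; exact le_abs_self _
    nlinarith
  have hm1 := aux _ hg0
  have hm2 := aux _ (hm i).symm
  simpa [hΔ, hm1, hm2] using hΔ0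

/-- If, at the candidate `β₀`, the residuals with index below `s` exceed `lam` in modulus with
signs `sgn` while the others are smaller than `lam`, and `β₀` solves the corresponding
estimating equation, then every penalized estimate equals `β₀`. -/
theorem IsPenalizedEstimate.eq_of_residuals {d n : ℕ} {lam : ℝ} (hlam : 0 < lam)
    {x : ℕ → Vec d} {y : ℕ → ℝ} {β : Vec d} {s : ℕ} (hs : s ≤ n) {sgn : ℕ → ℝ}
    (hsgn : ∀ i < s, |sgn i| = 1) (β₀ : Vec d)
    (hlarge : ∀ i < s, lam ≤ sgn i * (y i - inner ℝ (x i) β₀))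
    (hsmall : ∀ i < n, s ≤ i → |y i - inner ℝ (x i) β₀| < lam)
    (heq : ∑ i ∈ Finset.range s, (lam * sgn i) • x i +
      ∑ i ∈ Finset.Ico s n, (y i - inner ℝ (x i) β₀) • x i = 0)
    (hspan : ∀ v, (∀ i < n, s ≤ i → inner ℝ (x i) v = 0) → v = 0)
    (hβ : IsPenalizedEstimate lam (fun i : Fin n => x i) (fun i : Fin n => y i) β) : β = β₀ := by
  -- The clipped residual serves as dual variable; what clipping removes is the incidental parameter
  -- `m₀`.
  set e : ℕ → ℝ := fun i => if i < s then lam * sgn i else y i - inner ℝ (x i) β₀ with he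
  refine hβ.eq_of_certificate β₀ (fun i => y i - inner ℝ (x i) β₀ - e i) (fun i => e i)
    (fun i => by ring) (fun i => ?_) (fun i => ?_) ?_ (fun v hv => hspan v fun i hi hsi => ?_)
  · by_cases h : (i : ℕ) < s
    · simp [he, h, abs_mul, hsgn i h, abs_of_pos hlam]
    · simpa [he, h] using (hsmall i i.2 (not_lt.1 h)).le
  · by_cases h : (i : ℕ) < s
    · have h1 := hlarge i h
      have h2 := hsgn i h
      simp only [he, h, if_true]
      rcases (abs_eq zero_le_one).1 h2 with h3 | h3 <;> rw [h3] at h1 ⊢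
      · rw [abs_of_nonneg (by linarith)]; ring
      · rw [abs_of_nonpos (by linarith)]; ring
    · simp [he, h]
  · rw [Fin.sum_univ_eq_sum_range (fun i => e i • x i) n, Finset.range_eq_Ico,
      ← Finset.sum_Ico_consecutive _ (Nat.zero_le s) hs, ← Finset.range_eq_Ico, ← heq]
    congr 1
    · refine Finset.sum_congr rfl fun i hi => ?_
      simp [he, Finset.mem_range.1 hi]
    · refine Finset.sum_congr rfl fun i hi => ?_
      simp [he, not_lt.2 (Finset.mem_Ico.1 hi).1]
  · refine hv ⟨i, hi⟩ ?_
    simpa [he, not_lt.2 hsi] using hsmall i hi hsi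

end IncidentalRegression

/-! ### Characteristic functions of triangular arrays, and independence of pairs -/

namespace IncidentalRegression

/-- Factors are exchanged one at a time; the remaining ones have modulus at most one and do not
amplify the error. -/
theorem norm_prod_sub_prod_le_sum {ι : Type*} (s : Finset ι) (f g : ι → ℂ)
    (hf : ∀ i ∈ s, ‖f i‖ ≤ 1) (hg : ∀ i ∈ s, ‖g i‖ ≤ 1) :
    ‖∏ i ∈ s, f i - ∏ i ∈ s, g i‖ ≤ ∑ i ∈ s, ‖f i - g i‖ := by
  classical
  induction s using Finset.induction_on with
  | empty => simp
  | insert a s ha ih =>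
    rw [Finset.prod_insert ha, Finset.prod_insert ha, Finset.sum_insert ha]
    have ih' := ih (fun i hi => hf i (Finset.mem_insert_of_mem hi))
      (fun i hi => hg i (Finset.mem_insert_of_mem hi))
    have hP : ‖∏ i ∈ s, f i‖ ≤ 1 := by
      rw [norm_prod]
      exact Finset.prod_le_one (fun _ _ => norm_nonneg _)
        fun i hi => hf i (Finset.mem_insert_of_mem hi)
    have hga := hg a (Finset.mem_insert_self a s)
    calc ‖f a * ∏ i ∈ s, f i - g a * ∏ i ∈ s, g i‖
        = ‖(f a - g a) * ∏ i ∈ s, f i + g a * (∏ i ∈ s, f i - ∏ i ∈ s, g i)‖ := by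
          congr 1; ring
      _ ≤ ‖f a - g a‖ * ‖∏ i ∈ s, f i‖ + ‖g a‖ * ‖∏ i ∈ s, f i - ∏ i ∈ s, g i‖ := by
          refine (norm_add_le _ _).trans_eq ?_
          rw [norm_mul, norm_mul]
      _ ≤ ‖f a - g a‖ * 1 + 1 * ∑ i ∈ s, ‖f i - g i‖ := by gcongr
      _ = _ := by ring

theorem isLittleO_cexp_neg_sq (v : ℝ) :
    (fun u : ℝ => Complex.exp (-(v * u ^ 2 / 2 : ℝ)) - (1 - (v * u ^ 2 / 2 : ℝ)))
      =o[𝓝 0] fun u : ℝ => u ^ 2 := by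
  have h1 : (fun z : ℂ => Complex.exp z - 1 - z) =o[𝓝 0] fun z => z := by
    have := (hasDerivAt_iff_isLittleO.1 (Complex.hasDerivAt_exp 0))
    simpa using this
  have h2 : Tendsto (fun u : ℝ => (-(v * u ^ 2 / 2 : ℝ) : ℂ)) (𝓝 0) (𝓝 0) := by
    have : Continuous (fun u : ℝ => (-(v * u ^ 2 / 2 : ℝ) : ℂ)) := by fun_prop
    simpa using this.tendsto 0
  have h3 := h1.comp_tendsto h2
  have h4 : (fun u : ℝ => (-(v * u ^ 2 / 2 : ℝ) : ℂ)) =O[𝓝 0] fun u : ℝ => u ^ 2 := by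
    refine IsBigO.of_bound (|v| / 2) (Eventually.of_forall fun u => ?_)
    rw [norm_neg, Complex.norm_real, Real.norm_eq_abs, Real.norm_eq_abs, abs_div, abs_mul]
    simp only [abs_two]
    apply le_of_eq; ring
  refine (h3.trans_isBigO h4).congr_left fun u => ?_
  simp only [Function.comp]
  ring

/-- Second order comparison of a centred characteristic function with a Gaussian one. -/
theorem charFun_sub_gaussian_isLittleO {Ω : Type*} [MeasurableSpace Ω] {P : Measure Ω}
    [IsProbabilityMeasure P] {ξ : Ω → ℝ} (hξ : MemLp ξ 2 P) (h0 : ∫ ω, ξ ω ∂P = 0) :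
    (fun u : ℝ => charFun (P.map ξ) u - Complex.exp (-((∫ ω, ξ ω ^ 2 ∂P) * u ^ 2 / 2 : ℝ)))
      =o[𝓝 0] fun u : ℝ => u ^ 2 := by
  set v := ∫ ω, ξ ω ^ 2 ∂P with hv
  have hv0 : 0 ≤ v := integral_nonneg fun _ => sq_nonneg _
  -- The second-order Taylor expansion is for unit variance, so `ξ` is divided by `√v`; the
  -- degenerate case `v = 0`, where `ξ` vanishes almost surely, is separate.
  rcases hv0.eq_or_lt with h | h
  · have hz : ξ =ᵐ[P] fun _ => 0 := by
      have h5 := (integral_eq_zero_iff_of_nonneg (fun ω => sq_nonneg (ξ ω)) hξ.integrable_sq).1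
        h.symm
      filter_upwards [h5] with ω hω
      simpa using hω
    rw [Measure.map_congr hz, ← h]
    simp [charFun_dirac]
  · have hs : 0 < √v := Real.sqrt_pos.2 h
    have hmeas : AEMeasurable (fun ω => (√v)⁻¹ * ξ ω) P := hξ.aemeasurable.const_mul _
    have ht := taylor_charFun_two (P := P) (X := fun ω => (√v)⁻¹ * ξ ω) hmeas
      (by rw [integral_const_mul, h0, mul_zero])
      (by
        have : ((fun ω => (√v)⁻¹ * ξ ω) ^ 2) = fun ω => v⁻¹ * ξ ω ^ 2 := by
          ext ω
          simp [mul_pow, Real.sq_sqrt hv0]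
        rw [this, integral_const_mul, ← hv, inv_mul_cancel₀ h.ne'])
    have htend : Tendsto (fun u : ℝ => √v * u) (𝓝 0) (𝓝 0) := by
      simpa using (continuous_const_mul (√v)).tendsto (0 : ℝ)
    have h2 := ht.comp_tendsto htend
    have h3 : (fun u : ℝ => charFun (P.map ξ) u - (1 - (v * u ^ 2 / 2 : ℝ)))
        =o[𝓝 0] fun u : ℝ => u ^ 2 := by
      have h4 : (fun u : ℝ => (√v * u) ^ 2) =O[𝓝 0] fun u : ℝ => u ^ 2 := by
        refine IsBigO.of_bound v (Eventually.of_forall fun u => ?_)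
        rw [mul_pow, Real.sq_sqrt hv0, norm_mul, Real.norm_of_nonneg hv0]
      refine (h2.trans_isBigO h4).congr_left fun u => ?_
      simp only [Function.comp]
      rw [charFun_map_mul_comp hξ.aemeasurable, ← mul_assoc, inv_mul_cancel₀ hs.ne', one_mul]
      congr 2
      rw [← Complex.ofReal_pow, mul_pow, Real.sq_sqrt hv0]
      push_cast
      ring
    refine (h3.sub (isLittleO_cexp_neg_sq v)).congr_left fun u => ?_
    ring

/-- Products of characteristic functions at uniformly small, square-summable arguments are
asymptotically Gaussian. -/
theorem tendsto_prod_sub_gaussian {φ : ℝ → ℂ} {v : ℝ} (hv : 0 ≤ v) (hφ1 : ∀ u, ‖φ u‖ ≤ 1)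
    (hφ : (fun u : ℝ => φ u - Complex.exp (-(v * u ^ 2 / 2 : ℝ))) =o[𝓝 0] fun u : ℝ => u ^ 2)
    (s : ℕ → Finset ℕ) (a : ℕ → ℕ → ℝ)
    (hmax : ∀ η > 0, ∀ᶠ n in atTop, ∀ i ∈ s n, |a n i| < η)
    {K : ℝ} (hK : ∀ᶠ n in atTop, ∑ i ∈ s n, a n i ^ 2 ≤ K) :
    Tendsto (fun n => ∏ i ∈ s n, φ (a n i) -
      Complex.exp (-(v * (∑ i ∈ s n, a n i ^ 2) / 2 : ℝ))) atTop (𝓝 0) := by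
  rw [NormedAddGroup.tendsto_nhds_zero]
  intro η hη
  -- Chosen so that the accumulated error `c * K` stays below `η`, whatever the sign of `K`.
  set c := η / (2 * (|K| + 1)) with hc
  have hcpos : 0 < c := by positivity
  obtain ⟨ρ, hρ, hball⟩ := Metric.eventually_nhds_iff.1 (hφ.bound hcpos)
  filter_upwards [hmax ρ hρ, hK] with n hn hKn
  have hprod : Complex.exp (-(v * (∑ i ∈ s n, a n i ^ 2) / 2 : ℝ)) =
      ∏ i ∈ s n, Complex.exp (-(v * a n i ^ 2 / 2 : ℝ)) := by
    rw [← Complex.exp_sum]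
    congr 1
    push_cast
    rw [Finset.sum_neg_distrib, Finset.mul_sum, Finset.sum_div]
  rw [hprod]
  calc _ ≤ ∑ i ∈ s n, ‖φ (a n i) - Complex.exp (-(v * a n i ^ 2 / 2 : ℝ))‖ := by
        refine norm_prod_sub_prod_le_sum _ _ _ (fun i _ => hφ1 _) fun i _ => ?_
        rw [← Complex.ofReal_neg, Complex.norm_exp_ofReal, Real.exp_le_one_iff]
        have : 0 ≤ v * a n i ^ 2 / 2 := by positivity
        linarith
    _ ≤ ∑ i ∈ s n, c * a n i ^ 2 := by
        refine Finset.sum_le_sum fun i hi => ?_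
        have := hball (y := a n i) (by simpa using hn i hi)
        simpa using this
    _ ≤ c * K := by rw [← Finset.mul_sum]; gcongr
    _ ≤ c * (|K| + 1) := by gcongr; linarith [le_abs_self K]
    _ < η := by
        have : c * (|K| + 1) = η / 2 := by rw [hc]; field_simp
        linarith

/-- Measurable rectangles form a π-system generating each pair's σ-algebra. On rectangles the
probability factors first between the two sequences and then within each. -/
theorem iIndepFun_prodMk {Ω ι α β : Type*} [MeasurableSpace Ω] [MeasurableSpace α]
    [MeasurableSpace β] {P : Measure Ω} {X : ι → Ω → α} {Y : ι → Ω → β}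
    (mX : ∀ i, Measurable (X i)) (mY : ∀ i, Measurable (Y i))
    (hX : iIndepFun X P) (hY : iIndepFun Y P)
    (hXY : IndepFun (fun ω i => X i ω) (fun ω i => Y i ω) P) :
    iIndepFun (fun i ω => (X i ω, Y i ω)) P := by
  have := hX.isProbabilityMeasure
  refine iIndepSets.iIndep (π := fun i => {t | ∃ A B, MeasurableSet A ∧ MeasurableSet B ∧
    t = (fun ω => (X i ω, Y i ω)) ⁻¹' (A ×ˢ B)}) ?_ ?_ ?_ ?_
  · exact fun i => (((mX i).prodMk (mY i))).comap_le
  · rintro i _ ⟨A, B, hA, hB, rfl⟩ _ ⟨A', B', hA', hB', rfl⟩ -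
    exact ⟨A ∩ A', B ∩ B', hA.inter hA', hB.inter hB', by
      rw [← Set.preimage_inter, Set.prod_inter_prod]⟩
  · intro i
    rw [← generateFrom_prod, MeasurableSpace.comap_generateFrom]
    congr 1
    ext t
    constructor
    · rintro ⟨_, ⟨A, hA, B, hB, rfl⟩, rfl⟩
      exact ⟨A, B, hA, hB, rfl⟩
    · rintro ⟨A, B, hA, hB, rfl⟩
      exact ⟨_, ⟨A, hA, B, hB, rfl⟩, rfl⟩
  · rw [iIndepSets_iff]
    intro S f hf
    choose! A B hA hB hAB using hf
    have e1 : ∀ i ∈ S, P (f i) = P (X i ⁻¹' A i) * P (Y i ⁻¹' B i) := fun i hi => by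
      have h2 : IndepFun (X i) (Y i) P :=
        hXY.comp (measurable_pi_apply i) (measurable_pi_apply i)
      rw [hAB i hi, Set.mk_preimage_prod]
      exact h2.measure_inter_preimage_eq_mul _ _ (hA i hi) (hB i hi)
    have e2 : (⋂ i ∈ S, f i) = ((fun ω i => X i ω) ⁻¹' (⋂ i ∈ S, (fun z => z i) ⁻¹' A i)) ∩
        ((fun ω i => Y i ω) ⁻¹' (⋂ i ∈ S, (fun z => z i) ⁻¹' B i)) := by
      ext ω
      simp only [Set.mem_iInter, Set.mem_inter_iff, Set.mem_preimage]
      constructor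
      · intro h
        refine ⟨fun i hi => ?_, fun i hi => ?_⟩ <;>
        · have := h i hi
          rw [hAB i hi] at this
          first | exact this.1 | exact this.2
      · rintro ⟨h1, h2⟩ i hi
        rw [hAB i hi]
        exact ⟨h1 i hi, h2 i hi⟩
    rw [e2, hXY.measure_inter_preimage_eq_mul _ _
      (Finset.measurableSet_biInter _ fun i hi => measurable_pi_apply i (hA i hi))
      (Finset.measurableSet_biInter _ fun i hi => measurable_pi_apply i (hB i hi)),
      Finset.prod_congr rfl e1, Finset.prod_mul_distrib]
    simp only [Set.preimage_iInter]
    congr 1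
    · exact hX.measure_inter_preimage_eq_mul S hA
    · exact hY.measure_inter_preimage_eq_mul S hB

end IncidentalRegression

/-! ### Moments of weighted scores and their central limit theorem -/

namespace IncidentalRegression

theorem charFun_map_smul_comp_eq {Ω E : Type*} [MeasurableSpace Ω] {P : Measure Ω}
    [NormedAddCommGroup E] [InnerProductSpace ℝ E] [MeasurableSpace E] [BorelSpace E]
    [SecondCountableTopology E] {f : Ω → E} (hf : AEMeasurable f P) (a : ℝ) (u : E) :
    charFun (P.map fun ω => a • f ω) u = charFun (P.map fun ω => inner ℝ (f ω) u) a := by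
  rw [charFun_apply, charFun_apply, integral_map (by fun_prop) (by fun_prop),
    integral_map (by fun_prop) (by fun_prop)]
  simp [inner_smul_left]

theorem memLp_inner_const {Ω : Type*} [MeasurableSpace Ω] {P : Measure Ω} {d : ℕ}
    {f : Ω → Vec d} (hf : MemLp f 2 P) (u : Vec d) : MemLp (fun ω => inner ℝ (f ω) u) 2 P := by
  have := (innerSL ℝ u).comp_memLp' hf
  simpa [Function.comp_def, real_inner_comm] using this

theorem norm_smul_sq (a b t : ℝ) (x : Vec d) :
    ‖(a + b * t) • x‖ ^ 2 = (a + b * t) ^ 2 * ‖x‖ ^ 2 := by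
  rw [norm_smul, mul_pow, Real.norm_eq_abs, sq_abs]

namespace RandomDesign

variable {Ω : Type*} [MeasurableSpace Ω] {P : Measure Ω} {d : ℕ}
  {X : ℕ → Ω → Vec d} {ε : ℕ → Ω → ℝ} {σ : ℝ}

theorem indep_pair (h : RandomDesign P X ε σ) : iIndepFun (fun i ω => (X i ω, ε i ω)) P :=
  iIndepFun_prodMk h.measurable_X h.measurable_ε h.indep_X h.indep_ε h.indep_X_ε

theorem indepFun_X_ε (h : RandomDesign P X ε σ) (i : ℕ) : IndepFun (X i) (ε i) P :=
  h.indep_X_ε.comp (measurable_pi_apply i) (measurable_pi_apply i)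

theorem memLp_X' (h : RandomDesign P X ε σ) (i : ℕ) : MemLp (X i) 2 P :=
  (h.ident_X i).memLp_iff.2 h.memLp_X

theorem memLp_ε' (h : RandomDesign P X ε σ) (i : ℕ) : MemLp (ε i) 2 P :=
  (h.ident_ε i).memLp_iff.2 h.memLp_ε

theorem mean_X' (h : RandomDesign P X ε σ) (i : ℕ) : ∫ ω, X i ω ∂P = 0 :=
  (h.ident_X i).integral_eq.trans h.mean_X

theorem mean_ε' (h : RandomDesign P X ε σ) (i : ℕ) : ∫ ω, ε i ω ∂P = 0 :=
  (h.ident_ε i).integral_eq.trans h.mean_ε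

theorem integral_sq_ε (h : RandomDesign P X ε σ) (i : ℕ) : ∫ ω, ε i ω ^ 2 ∂P = σ ^ 2 := by
  have h1 : ∫ ω, ε i ω ^ 2 ∂P = ∫ ω, ε 0 ω ^ 2 ∂P :=
    ((h.ident_ε i).comp (u := fun x : ℝ => x ^ 2) (by fun_prop)).integral_eq
  rw [h1, ← h.var_ε, variance_eq_integral (h.measurable_ε 0).aemeasurable, h.mean_ε]
  simp

theorem indepFun_affine (h : RandomDesign P X ε σ) (i : ℕ) (a b : ℝ) :
    IndepFun (fun ω => a + b * ε i ω) (X i) P :=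
  (h.indepFun_X_ε i).symm.comp (φ := fun t : ℝ => a + b * t) (by fun_prop) measurable_id

theorem integrable_sq_norm_X (h : RandomDesign P X ε σ) (i : ℕ) :
    Integrable (fun ω => ‖X i ω‖ ^ 2) P :=
  (memLp_two_iff_integrable_sq_norm (h.measurable_X i).aestronglyMeasurable).1 (h.memLp_X' i)

theorem indepFun_affine_sq (h : RandomDesign P X ε σ) (i : ℕ) (a b : ℝ) :
    IndepFun (fun ω => (a + b * ε i ω) ^ 2) (fun ω => ‖X i ω‖ ^ 2) P :=
  (h.indepFun_affine i a b).comp (φ := fun t : ℝ => t ^ 2) (ψ := fun x : Vec d => ‖x‖ ^ 2)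
    (by fun_prop) (by fun_prop)

variable [IsProbabilityMeasure P]

theorem integral_affine_sq (h : RandomDesign P X ε σ) (i : ℕ) (a b : ℝ) :
    ∫ ω, (a + b * ε i ω) ^ 2 ∂P = a ^ 2 + b ^ 2 * σ ^ 2 := by
  have h1 := (h.memLp_ε' i).integrable_sq
  have h2 : Integrable (ε i) P := (h.memLp_ε' i).integrable one_le_two
  have : ∀ ω, (a + b * ε i ω) ^ 2 = a ^ 2 + (2 * a * b) * ε i ω + b ^ 2 * ε i ω ^ 2 :=
    fun ω => by ring
  simp_rw [this]
  have h3 : Integrable (fun ω => a ^ 2 + 2 * a * b * ε i ω) P :=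
    (integrable_const _).add (h2.const_mul _)
  rw [integral_add h3 (h1.const_mul _), integral_add (integrable_const _) (h2.const_mul _), integral_const_mul, integral_const_mul,
    h.mean_ε', h.integral_sq_ε]
  simp

theorem memLp_affine (h : RandomDesign P X ε σ) (i : ℕ) (a b : ℝ) :
    MemLp (fun ω => a + b * ε i ω) 2 P :=
  (memLp_const a).add ((h.memLp_ε' i).const_mul b)

theorem memLp_score (h : RandomDesign P X ε σ) (i : ℕ) (a b : ℝ) :
    MemLp (fun ω => (a + b * ε i ω) • X i ω) 2 P := by
  have mX := h.measurable_X i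
  have mε := h.measurable_ε i
  rw [memLp_two_iff_integrable_sq_norm (by fun_prop)]
  simp_rw [norm_smul_sq]
  exact (h.indepFun_affine_sq i a b).integrable_mul (h.memLp_affine i a b).integrable_sq
    (h.integrable_sq_norm_X i)

theorem integral_sq_norm_score (h : RandomDesign P X ε σ) (i : ℕ) (a b : ℝ) :
    ∫ ω, ‖(a + b * ε i ω) • X i ω‖ ^ 2 ∂P =
      (a ^ 2 + b ^ 2 * σ ^ 2) * ∫ ω, ‖X 0 ω‖ ^ 2 ∂P := by
  have mX := h.measurable_X i
  have mε := h.measurable_ε i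
  simp_rw [norm_smul_sq]
  have h1 : ∫ ω, ‖X i ω‖ ^ 2 ∂P = ∫ ω, ‖X 0 ω‖ ^ 2 ∂P :=
    ((h.ident_X i).comp (u := fun x : Vec d => ‖x‖ ^ 2) (by fun_prop)).integral_eq
  rw [← h.integral_affine_sq i a b, ← h1]
  exact (h.indepFun_affine_sq i a b).integral_mul_eq_mul_integral
    (by fun_prop) (by fun_prop)

theorem integral_score (h : RandomDesign P X ε σ) (i : ℕ) (a b : ℝ) :
    ∫ ω, (a + b * ε i ω) • X i ω ∂P = 0 := by
  have := (h.indepFun_affine i a b).integral_bilin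
    ((h.memLp_affine i a b).integrable one_le_two) ((h.memLp_X' i).integrable one_le_two)
    (ContinuousLinearMap.lsmul ℝ ℝ)
  simpa only [ContinuousLinearMap.lsmul_apply, h.mean_X', smul_zero] using this

/-- Distinct summands are independent and centred, hence orthogonal in `L²`, so only the diagonal
survives. -/
theorem integral_sq_norm_sum_score (h : RandomDesign P X ε σ) (s : Finset ℕ) (a b : ℕ → ℝ) :
    ∫ ω, ‖∑ i ∈ s, (a i + b i * ε i ω) • X i ω‖ ^ 2 ∂P =
      (∑ i ∈ s, (a i ^ 2 + b i ^ 2 * σ ^ 2)) * ∫ ω, ‖X 0 ω‖ ^ 2 ∂P := by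
  set w : ℕ → Ω → Vec d := fun i ω => (a i + b i * ε i ω) • X i ω with hw
  have hL : ∀ i, MemLp (w i) 2 P := fun i => h.memLp_score i _ _
  have hind : ∀ i j, i ≠ j → IndepFun (w i) (w j) P := fun i j hij =>
    (h.indep_pair.indepFun hij).comp (φ := fun z : Vec d × ℝ => (a i + b i * z.2) • z.1)
      (ψ := fun z : Vec d × ℝ => (a j + b j * z.2) • z.1) (by fun_prop) (by fun_prop)
  have hint : ∀ i j, Integrable (fun ω => inner ℝ (w i ω) (w j ω)) P := fun i j => by
    refine ((hL i).norm.integrable_mul (hL j).norm).mono'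
      ((hL i).1.inner (hL j).1) (Eventually.of_forall fun ω => norm_inner_le_norm _ _)
  have hcross : ∀ i j, i ≠ j → ∫ ω, inner ℝ (w i ω) (w j ω) ∂P = 0 := fun i j hij => by
    have := (hind i j hij).integral_bilin ((hL i).integrable one_le_two)
      ((hL j).integrable one_le_two) (innerSL ℝ)
    rw [show ∫ ω, w i ω ∂P = 0 from h.integral_score i _ _, map_zero] at this
    exact this
  calc _ = ∫ ω, ∑ i ∈ s, ∑ j ∈ s, inner ℝ (w i ω) (w j ω) ∂P := by
        refine integral_congr_ae (Eventually.of_forall fun ω => ?_)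
        simp only [← real_inner_self_eq_norm_sq, sum_inner, inner_sum, hw]
        exact Finset.sum_comm
    _ = ∑ i ∈ s, ∑ j ∈ s, ∫ ω, inner ℝ (w i ω) (w j ω) ∂P := by
        rw [integral_finsetSum _ fun i _ => integrable_finsetSum _ fun j _ => hint i j]
        exact Finset.sum_congr rfl fun i _ => integral_finsetSum _ fun j _ => hint i j
    _ = ∑ i ∈ s, ∫ ω, ‖w i ω‖ ^ 2 ∂P := by
        refine Finset.sum_congr rfl fun i hi => ?_
        rw [Finset.sum_eq_single_of_mem i hi fun j _ hji => hcross i j hji.symm]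
        simp_rw [real_inner_self_eq_norm_sq]
    _ = _ := by
        rw [Finset.sum_mul]
        exact Finset.sum_congr rfl fun i _ => h.integral_sq_norm_score i _ _

/-- Chebyshev's inequality; every remainder involving a score is controlled through this bound. -/
theorem measureReal_sum_score_le (h : RandomDesign P X ε σ) (s : Finset ℕ) (a b : ℕ → ℝ)
    {K : ℝ} (hK : 0 < K) :
    P.real {ω | K ≤ ‖∑ i ∈ s, (a i + b i * ε i ω) • X i ω‖} ≤
      (∑ i ∈ s, (a i ^ 2 + b i ^ 2 * σ ^ 2)) * (∫ ω, ‖X 0 ω‖ ^ 2 ∂P) / K ^ 2 := by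
  have hL : MemLp (fun ω => ∑ i ∈ s, (a i + b i * ε i ω) • X i ω) 2 P :=
    memLp_finsetSum _ fun i _ => h.memLp_score i _ _
  have := mul_meas_ge_le_integral_of_nonneg (μ := P)
    (f := fun ω => ‖∑ i ∈ s, (a i + b i * ε i ω) • X i ω‖ ^ 2)
    (Eventually.of_forall fun ω => sq_nonneg _)
    ((memLp_two_iff_integrable_sq_norm hL.1).1 hL) (K ^ 2)
  rw [h.integral_sq_norm_sum_score] at this
  rw [le_div_iff₀ (by positivity), mul_comm]
  simpa only [sq_le_sq₀ hK.le (norm_nonneg _)] using this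

/-- Central limit theorem for weighted sums of covariates and of error-weighted covariates. -/
theorem tendsto_charFun_weighted (h : RandomDesign P X ε σ) (m : ℕ → ℕ) (hmn : ∀ n, m n ≤ n)
    (a : ℕ → ℕ → ℝ) (ρ : ℕ → ℝ)
    (hmax : ∀ η > 0, ∀ᶠ n in atTop, ∀ i ∈ Finset.range (m n), |a n i| < η)
    (hρ : Tendsto ρ atTop (𝓝 0)) {K : ℝ} (hρK : ∀ᶠ n in atTop, n * ρ n ^ 2 ≤ K) {τ : ℝ}
    (hτ : Tendsto (fun n : ℕ => ∑ i ∈ Finset.range (m n), a n i ^ 2 +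
      ((n : ℝ) - m n) * ρ n ^ 2 * σ ^ 2) atTop (𝓝 τ)) (u : Vec d) :
    Tendsto (fun n : ℕ => charFun (P.map fun ω => ∑ i ∈ Finset.range (m n), a n i • X i ω +
      ∑ i ∈ Finset.Ico (m n) n, (ρ n * ε i ω) • X i ω) u) atTop
      (𝓝 (Complex.exp (-(τ * (∫ ω, inner ℝ (X 0 ω) u ^ 2 ∂P) / 2 : ℝ)))) := by
  have mX := h.measurable_X
  have mε := h.measurable_ε
  set v := ∫ ω, inner ℝ (X 0 ω) u ^ 2 ∂P with hv
  have hv0 : 0 ≤ v := integral_nonneg fun _ => sq_nonneg _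
  set ξ : Ω → ℝ := fun ω => inner ℝ (X 0 ω) u with hξ
  -- The form `0 + 1 * ε` lets the moment lemmas for affine weights apply with `a = 0`, `b = 1`.
  set ζ : Ω → ℝ := fun ω => inner ℝ ((0 + 1 * ε 0 ω) • X 0 ω) u with hζ
  have hξL : MemLp ξ 2 P := memLp_inner_const (h.memLp_X' 0) u
  have hζL : MemLp ζ 2 P := memLp_inner_const (h.memLp_score 0 0 1) u
  have hξ0 : ∫ ω, ξ ω ∂P = 0 := by
    have := (innerSL ℝ u).integral_comp_comm ((h.memLp_X' 0).integrable one_le_two)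
    simpa [hξ, real_inner_comm, h.mean_X] using this
  have hζ0 : ∫ ω, ζ ω ∂P = 0 := by
    have := (innerSL ℝ u).integral_comp_comm ((h.memLp_score 0 0 1).integrable one_le_two)
    simpa only [hζ, innerSL_apply_apply, real_inner_comm u, h.integral_score, inner_zero_right]
      using this
  have hζv : ∫ ω, ζ ω ^ 2 ∂P = σ ^ 2 * v := by
    have hi : IndepFun (fun ω => ε 0 ω ^ 2) (fun ω => ξ ω ^ 2) P :=
      (h.indepFun_X_ε 0).symm.comp (φ := fun t : ℝ => t ^ 2)
        (ψ := fun x : Vec d => inner ℝ x u ^ 2) (by fun_prop) (by fun_prop)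
    have := hi.integral_mul_eq_mul_integral (by fun_prop) (by fun_prop)
    rw [h.integral_sq_ε] at this
    rw [← this]
    refine integral_congr_ae (Eventually.of_forall fun ω => ?_)
    simp [hζ, hξ, inner_smul_left, mul_pow]
  have hA := charFun_sub_gaussian_isLittleO hξL hξ0
  have hB := charFun_sub_gaussian_isLittleO hζL hζ0
  rw [hζv] at hB
  have hle : ∀ (f : Ω → ℝ), AEMeasurable f P → ∀ t, ‖charFun (P.map f) t‖ ≤ 1 := fun f hf t => by
    have := Measure.isProbabilityMeasure_map hf
    exact norm_charFun_le_one t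
  have hcard : ∀ n, ∑ i ∈ Finset.Ico (m n) n, ρ n ^ 2 = ((n : ℝ) - m n) * ρ n ^ 2 := fun n => by
    rw [Finset.sum_const, Nat.card_Ico, nsmul_eq_mul, Nat.cast_sub (hmn n)]
  have hmn' : ∀ n : ℕ, (0 : ℝ) ≤ (n : ℝ) - m n := fun n => sub_nonneg.2 (by exact_mod_cast hmn n)
  have hlimA := tendsto_prod_sub_gaussian hv0 (hle ξ hξL.aemeasurable) hA
    (fun n => Finset.range (m n)) a hmax (K := τ + 1) (by
      filter_upwards [hτ.eventually_le_const (show τ < τ + 1 by linarith)] with n hn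
      have : 0 ≤ ((n : ℝ) - m n) * ρ n ^ 2 * σ ^ 2 :=
        mul_nonneg (mul_nonneg (hmn' n) (sq_nonneg _)) (sq_nonneg _)
      linarith)
  have hlimB := tendsto_prod_sub_gaussian (mul_nonneg (sq_nonneg σ) hv0)
    (hle ζ hζL.aemeasurable) hB
    (fun n => Finset.Ico (m n) n) (fun n _ => ρ n) (fun η hη => by
      filter_upwards [(tendsto_order.1 hρ.abs).2 η (by simpa using hη)] with n hn i _
      exact hn) (K := K) (by
      filter_upwards [hρK] with n hn
      rw [hcard]
      refine le_trans ?_ hn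
      have : (0 : ℝ) ≤ m n := Nat.cast_nonneg _
      nlinarith [sq_nonneg (ρ n)])
  -- Independence over `i` concerns the pairs `(X i, ε i)`, so both blocks are written as functions
  -- of these pairs. Identical distribution then leaves just two characteristic functions, those of
  -- `ξ` and `ζ`.
  have hcf : ∀ n : ℕ, charFun (P.map fun ω => ∑ i ∈ Finset.range (m n), a n i • X i ω +
      ∑ i ∈ Finset.Ico (m n) n, (ρ n * ε i ω) • X i ω) u =
      (∏ i ∈ Finset.range (m n), charFun (P.map ξ) (a n i)) *
        ∏ i ∈ Finset.Ico (m n) n, charFun (P.map ζ) (ρ n) := fun n => by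
    set g : ℕ → Vec d × ℝ → Vec d := fun i z =>
      if i < m n then a n i • z.1 else (ρ n * z.2) • z.1 with hg
    have mg : ∀ i, Measurable (g i) := fun i => by
      by_cases hi : i < m n
      · simp only [hg, hi, if_true]; fun_prop
      · simp only [hg, hi, if_false]; fun_prop
    have hsplit : (fun ω => ∑ i ∈ Finset.range (m n), a n i • X i ω +
        ∑ i ∈ Finset.Ico (m n) n, (ρ n * ε i ω) • X i ω) =
        fun ω => ∑ i ∈ Finset.range n, g i (X i ω, ε i ω) := by
      ext1 ω
      rw [Finset.range_eq_Ico, Finset.range_eq_Ico,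
        ← Finset.sum_Ico_consecutive (fun i => g i (X i ω, ε i ω)) (Nat.zero_le (m n)) (hmn n)]
      congr 1
      · refine Finset.sum_congr rfl fun i hi => ?_
        simp [hg, (Finset.mem_Ico.1 hi).2]
      · refine Finset.sum_congr rfl fun i hi => ?_
        simp [hg, not_lt.2 (Finset.mem_Ico.1 hi).1]
    have hi := h.indep_pair.comp g mg
    rw [hsplit, (hi.restrict (Finset.range n)).charFun_map_fun_finsetSum_eq_prod
      (X := fun i ω => g i (X i ω, ε i ω)) fun i _ =>
        ((mg i).comp ((mX i).prodMk (mε i))).aemeasurable,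
      Finset.prod_apply, Finset.range_eq_Ico,
      ← Finset.prod_Ico_consecutive _ (Nat.zero_le (m n)) (hmn n), Finset.range_eq_Ico]
    congr 1
    · refine Finset.prod_congr rfl fun i hi => ?_
      simp only [hg, (Finset.mem_Ico.1 hi).2, if_true]
      rw [charFun_map_smul_comp_eq (mX i).aemeasurable]
      congr 1
      exact ((h.ident_X i).comp (u := fun x : Vec d => inner ℝ x u) (by fun_prop)).map_eq
    · refine Finset.prod_congr rfl fun i hi => ?_
      simp only [hg, not_lt.2 (Finset.mem_Ico.1 hi).1, if_false, mul_smul]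
      rw [charFun_map_smul_comp_eq (f := fun ω => ε i ω • X i ω) (by fun_prop)]
      congr 1
      have hid := (h.ident_X i).prodMk (h.ident_ε i) (h.indepFun_X_ε i) (h.indepFun_X_ε 0)
      have := (hid.comp (u := fun z : Vec d × ℝ => inner ℝ (z.2 • z.1) u) (by fun_prop)).map_eq
      simpa [hζ, Function.comp_def] using this
  simp_rw [hcf]
  set A : ℕ → ℂ := fun n => ∏ i ∈ Finset.range (m n), charFun (P.map ξ) (a n i) with hAdef
  set B : ℕ → ℂ := fun n => ∏ i ∈ Finset.Ico (m n) n, charFun (P.map ζ) (ρ n) with hBdef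
  set GA : ℕ → ℂ := fun n =>
    Complex.exp (-(v * (∑ i ∈ Finset.range (m n), a n i ^ 2) / 2 : ℝ)) with hGA
  set GB : ℕ → ℂ := fun n =>
    Complex.exp (-(σ ^ 2 * v * (∑ i ∈ Finset.Ico (m n) n, ρ n ^ 2) / 2 : ℝ)) with hGB
  have hB1 : ∀ n, ‖B n‖ ≤ 1 := fun n => by
    rw [hBdef, norm_prod]
    exact Finset.prod_le_one (fun _ _ => norm_nonneg _) fun i _ => hle ζ hζL.aemeasurable _
  have hGA1 : ∀ n, ‖GA n‖ ≤ 1 := fun n => by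
    simp only [hGA]
    rw [← Complex.ofReal_neg, Complex.norm_exp_ofReal, Real.exp_le_one_iff]
    have : 0 ≤ v * (∑ i ∈ Finset.range (m n), a n i ^ 2) / 2 :=
      div_nonneg (mul_nonneg hv0 (Finset.sum_nonneg fun _ _ => sq_nonneg _)) two_pos.le
    linarith
  have hprod : Tendsto (fun n => GA n * GB n) atTop (𝓝 (Complex.exp (-(τ * v / 2 : ℝ)))) := by
    have hcont : Continuous fun t : ℝ => Complex.exp (-(t * v / 2 : ℝ)) := by fun_prop
    refine ((hcont.tendsto τ).comp hτ).congr fun n => ?_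
    simp only [hGA, hGB, Function.comp, ← Complex.exp_add, hcard]
    congr 1
    push_cast
    ring
  -- Telescoping of `A B - GA GB`; boundedness of `B` and `GA` keeps each difference negligible.
  have hdiff : Tendsto (fun n => (A n - GA n) * B n + GA n * (B n - GB n)) atTop (𝓝 0) := by
    have hb1 : IsBoundedUnder (· ≤ ·) atTop ((‖·‖) ∘ B) := ⟨1, by simpa using ⟨0, fun n _ => hB1 n⟩⟩
    have hb2 : IsBoundedUnder (· ≤ ·) atTop ((‖·‖) ∘ GA) :=
      ⟨1, by simpa using ⟨0, fun n _ => hGA1 n⟩⟩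
    simpa only [add_zero] using (hlimA.zero_mul_isBoundedUnder_le hb1).add
      (isBoundedUnder_le_mul_tendsto_zero hb2 hlimB)
  have := hdiff.add hprod
  rw [zero_add] at this
  refine this.congr fun n => ?_
  ring

end RandomDesign

end IncidentalRegression

/-! ### The linear estimating equation and the Gram operator -/

namespace IncidentalRegression

/-- The deterministic weights of the covariates in the estimating equation: `lam` times the sign of
the incidental parameter for the first `s` observations, the parameter itself for the others. -/
noncomputable def scoreShift (lam : ℝ) (s : ℕ) (m : ℕ → ℝ) (i : ℕ) : ℝ :=
  if i < s then lam * (m i / |m i|) else m i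

/-- The weights of the errors in the estimating equation. -/
noncomputable def scoreNoise (s i : ℕ) : ℝ := if i < s then 0 else 1

/-- The right-hand side of the normalized estimating equation. -/
noncomputable def normalizedScore {d : ℕ} (lam : ℝ) (s : ℕ) (m : ℕ → ℝ) (x : ℕ → Vec d)
    (e : ℕ → ℝ) (n : ℕ) : Vec d :=
  (n : ℝ)⁻¹ • ∑ i ∈ Finset.range n, (scoreShift lam s m i + scoreNoise s i * e i) • x i

/-- The normalized Gram operator of the observations with index in `[s, n)`. -/
noncomputable def gramOperator {d : ℕ} (s : ℕ) (x : ℕ → Vec d) (n : ℕ) : Vec d →L[ℝ] Vec d :=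
  (n : ℝ)⁻¹ • ∑ i ∈ Finset.Ico s n, InnerProductSpace.rankOne ℝ (x i) (x i)

theorem gramOperator_apply {d : ℕ} (s : ℕ) (x : ℕ → Vec d) (n : ℕ) (v : Vec d) :
    gramOperator s x n v = (n : ℝ)⁻¹ • ∑ i ∈ Finset.Ico s n, (inner ℝ (x i) v) • x i := by
  simp [gramOperator]

theorem continuous_rankOne_self {d : ℕ} :
    Continuous fun x : Vec d => InnerProductSpace.rankOne ℝ x x := by
  have h : ∀ x : Vec d, InnerProductSpace.rankOne ℝ x x =
      ContinuousLinearMap.smulRightL ℝ (Vec d) (Vec d) (innerSL ℝ x) x := fun x => rfl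
  simp_rw [h]
  fun_prop

/-- A left inverse up to error `1/2` still gives a lower bound on `A`. This one estimate supplies
injectivity of the Gram operator, the size of its solution, and the spanning property of the
unclipped covariates. -/
theorem norm_le_of_approx_inverse {E : Type*} [NormedAddCommGroup E] [NormedSpace ℝ E]
    {G A : E →L[ℝ] E} (hGA : ‖1 - G * A‖ ≤ 1 / 2) (v : E) : ‖v‖ ≤ 2 * ‖G (A v)‖ := by
  have h1 : v = G (A v) + (1 - G * A) v := by simp
  have h2 : ‖(1 - G * A) v‖ ≤ 1 / 2 * ‖v‖ :=
    ((1 - G * A).le_opNorm v).trans (by gcongr)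
  have h3 : ‖v‖ ≤ ‖G (A v)‖ + ‖(1 - G * A) v‖ := by
    conv_lhs => rw [h1]
    exact norm_add_le _ _
  linarith

/-- On the event where the covariates, errors and the score are suitably bounded, every penalized
estimate solves the linear estimating equation. -/
theorem gramOperator_estimate_eq {d n s : ℕ} (hs : s ≤ n) {lam κ γ : ℝ} (hlam : 0 < lam)
    (hγ : 0 < γ) (hκ : 0 < κ) (hgap : 2 * γ + κ < lam)
    {x : ℕ → Vec d} {e m : ℕ → ℝ} (hx : ∀ i < n, ‖x i‖ ≤ κ) (he : ∀ i < n, |e i| ≤ γ)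
    (hlarge : ∀ i < s, lam + γ + κ ≤ |m i|) (hsmall : ∀ i < n, s ≤ i → |m i| ≤ γ)
    {G : Vec d →L[ℝ] Vec d} (hG : ‖1 - G * gramOperator s x n‖ ≤ 1 / 2)
    (hscore : 2 * (‖G‖ * ‖normalizedScore lam s m x e n‖) ≤ 1) {βstar β : Vec d}
    (hβ : IsPenalizedEstimate lam (fun i : Fin n => x i)
      (fun i : Fin n => m i + inner ℝ (x i) βstar + e i) β) :
    gramOperator s x n (β - βstar) = normalizedScore lam s m x e n := by
  set A := gramOperator s x n with hA
  have hinj : Function.Injective A := by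
    refine (injective_iff_map_eq_zero A).2 fun v hv => ?_
    have := norm_le_of_approx_inverse hG v
    rw [hv, map_zero, norm_zero, mul_zero] at this
    exact norm_le_zero_iff.1 this
  obtain ⟨θ, hθ⟩ := (LinearMap.injective_iff_surjective (f := A.toLinearMap)).1 hinj
    (normalizedScore lam s m x e n)
  replace hθ : A θ = normalizedScore lam s m x e n := hθ
  -- With `‖θ‖ ≤ 1`, moving from `βstar` to `βstar + θ` changes each residual by at most `κ`. Hence
  -- residuals of small parameters are at most `2γ + κ < lam`, while those of large ones keep their
  -- sign and exceed `lam` after losing at most `γ + κ`.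
  have hθ1 : ‖θ‖ ≤ 1 := by
    refine (norm_le_of_approx_inverse hG θ).trans ?_
    rw [hθ]
    exact (mul_le_mul_of_nonneg_left (G.le_opNorm _) two_pos.le).trans hscore
  have hxθ : ∀ i < n, |inner ℝ (x i) θ| ≤ κ := fun i hi =>
    (abs_real_inner_le_norm _ _).trans (by nlinarith [hx i hi, norm_nonneg (x i), norm_nonneg θ])
  have hres : ∀ i, m i + inner ℝ (x i) βstar + e i - inner ℝ (x i) (βstar + θ) =
      m i + e i - inner ℝ (x i) θ := fun i => by rw [inner_add_right]; ring
  -- The factor `n⁻¹` is cancelled below; for `n = 0` both sides are zero.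
  rcases Nat.eq_zero_or_pos n with rfl | hn
  · simp [hA, gramOperator, normalizedScore]
  have hn0 : (n : ℝ) ≠ 0 := by positivity
  suffices β = βstar + θ by rw [this, add_sub_cancel_left, hθ]
  refine IsPenalizedEstimate.eq_of_residuals (y := fun i => m i + inner ℝ (x i) βstar + e i) hlam hs
    (sgn := fun i => m i / |m i|)
    (fun i hi => ?_) (βstar + θ) (fun i hi => ?_) (fun i hi hsi => ?_) ?_ (fun v hv => ?_) hβ
  · have := hlarge i hi
    rw [abs_div, abs_abs, div_self (by linarith)]
  · have h1 := hlarge i hi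
    have h2 := abs_le.1 (he i (hi.trans_le hs))
    have h3 := abs_le.1 (hxθ i (hi.trans_le hs))
    simp only [hres]
    rcases le_or_gt 0 (m i) with h | h
    · rw [abs_of_nonneg h] at h1 ⊢
      rw [div_self (by linarith)]
      linarith
    · rw [abs_of_neg h] at h1 ⊢
      rw [div_neg, div_self h.ne]
      linarith
  · have h1 := abs_le.1 (hsmall i hi hsi)
    have h2 := abs_le.1 (he i hi)
    have h3 := abs_le.1 (hxθ i hi)
    simp only [hres]
    rw [abs_lt]
    constructor <;> linarith
  · simp only [hres]
    have h1 := hθ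
    rw [hA, gramOperator_apply, normalizedScore] at h1
    have h2 := smul_right_injective (Vec d) (inv_ne_zero hn0) h1
    rw [Finset.range_eq_Ico, ← Finset.sum_Ico_consecutive _ (Nat.zero_le s) hs] at h2
    have h3 : ∑ i ∈ Finset.Ico 0 s, (scoreShift lam s m i + scoreNoise s i * e i) • x i =
        ∑ i ∈ Finset.range s, (lam * (m i / |m i|)) • x i := by
      rw [Finset.range_eq_Ico]
      refine Finset.sum_congr rfl fun i hi => ?_
      simp [scoreShift, scoreNoise, (Finset.mem_Ico.1 hi).2]
    have h4 : ∑ i ∈ Finset.Ico s n, (scoreShift lam s m i + scoreNoise s i * e i) • x i =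
        ∑ i ∈ Finset.Ico s n, (m i + e i) • x i := by
      refine Finset.sum_congr rfl fun i hi => ?_
      simp [scoreShift, scoreNoise, not_lt.2 (Finset.mem_Ico.1 hi).1]
    rw [h3, h4] at h2
    simp only [sub_smul, Finset.sum_sub_distrib, h2]
    abel
  · have := norm_le_of_approx_inverse hG v
    rw [gramOperator_apply, Finset.sum_eq_zero, smul_zero, map_zero, norm_zero, mul_zero] at this
    · exact norm_le_zero_iff.1 this
    · intro i hi
      rw [hv i (Finset.mem_Ico.1 hi).2 (Finset.mem_Ico.1 hi).1, zero_smul]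

namespace RandomDesign

variable {Ω : Type*} [MeasurableSpace Ω] {P : Measure Ω} {d : ℕ}
  {X : ℕ → Ω → Vec d} {ε : ℕ → Ω → ℝ} {σ : ℝ}

theorem measurable_rankOne (h : RandomDesign P X ε σ) (i : ℕ) :
    Measurable fun ω => InnerProductSpace.rankOne ℝ (X i ω) (X i ω) := by
  exact continuous_rankOne_self.measurable.comp (h.measurable_X i)

theorem integrable_rankOne (h : RandomDesign P X ε σ) :
    Integrable (fun ω => InnerProductSpace.rankOne ℝ (X 0 ω) (X 0 ω)) P := by
  refine (h.integrable_sq_norm_X 0).mono' (h.measurable_rankOne 0).aestronglyMeasurable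
    (Eventually.of_forall fun ω => ?_)
  rw [InnerProductSpace.norm_rankOne, sq]

variable [IsProbabilityMeasure P]

theorem covMatrix_apply (h : RandomDesign P X ε σ) (j k : Fin d) :
    covMatrix P (X 0) j k = ∫ ω, X 0 ω j * X 0 ω k ∂P := by
  have hint := (h.memLp_X' 0).integrable one_le_two
  have hz : ∀ j, ∫ ω, X 0 ω j ∂P = 0 := fun j => by
    have := (EuclideanSpace.proj (𝕜 := ℝ) j).integral_comp_comm hint
    simpa [h.mean_X] using this
  simp [covMatrix, covariance, hz]

theorem integral_rankOne (h : RandomDesign P X ε σ) :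
    ∫ ω, InnerProductSpace.rankOne ℝ (X 0 ω) (X 0 ω) ∂P =
      Matrix.toEuclideanCLM (𝕜 := ℝ) (covMatrix P (X 0)) := by
  ext v j
  have hc : ∀ k : Fin d, MemLp (fun ω => X 0 ω k) 2 P := fun k =>
    (EuclideanSpace.proj (𝕜 := ℝ) k).comp_memLp' (h.memLp_X' 0)
  have h1 := ContinuousLinearMap.integral_comp_comm
    ((EuclideanSpace.proj (𝕜 := ℝ) j).comp (ContinuousLinearMap.apply ℝ (Vec d) v))
    h.integrable_rankOne
  have h2 : ∀ ω, ((EuclideanSpace.proj (𝕜 := ℝ) j).comp (ContinuousLinearMap.apply ℝ (Vec d) v))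
      (InnerProductSpace.rankOne ℝ (X 0 ω) (X 0 ω)) = ∑ k, (X 0 ω j * X 0 ω k) * v k := fun ω => by
    simp [PiLp.inner_apply, Finset.sum_mul]
    refine Finset.sum_congr rfl fun k _ => by ring
  simp_rw [h2] at h1
  have h3 : ∀ k, Integrable (fun ω => X 0 ω j * X 0 ω k * v k) P := fun k =>
    ((hc j).integrable_mul (hc k)).mul_const _
  rw [integral_finsetSum _ fun k _ => h3 k] at h1
  simp_rw [integral_mul_const, ← h.covMatrix_apply] at h1
  exact h1.symm

theorem integral_inner_sq (h : RandomDesign P X ε σ) (u : Vec d) :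
    ∫ ω, inner ℝ (X 0 ω) u ^ 2 ∂P =
      inner ℝ u (Matrix.toEuclideanCLM (𝕜 := ℝ) (covMatrix P (X 0)) u) := by
  rw [← h.integral_rankOne]
  have h1 := ContinuousLinearMap.integral_comp_comm
    ((innerSL ℝ u).comp (ContinuousLinearMap.apply ℝ (Vec d) u)) h.integrable_rankOne
  simp only [ContinuousLinearMap.comp_apply, ContinuousLinearMap.apply_apply,
    innerSL_apply_apply, InnerProductSpace.rankOne_apply, inner_smul_right] at h1
  rw [← h1]
  refine integral_congr_ae (Eventually.of_forall fun ω => ?_)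
  simp only [real_inner_comm u]
  ring

/-- Strong law of large numbers for the Gram operator when a negligible number of observations is
discarded. -/
theorem tendsto_gramOperator (h : RandomDesign P X ε σ) {s : ℕ → ℕ} (hs : ∀ n, s n ≤ n)
    (hs_top : Tendsto s atTop atTop)
    (hs_small : (fun n : ℕ => (s n : ℝ)) =o[atTop] fun n : ℕ => (n : ℝ)) :
    ∀ᵐ ω ∂P, Tendsto (fun n => gramOperator (s n) (fun i => X i ω) n) atTop
      (𝓝 (Matrix.toEuclideanCLM (𝕜 := ℝ) (covMatrix P (X 0)))) := by
  have hc := continuous_rankOne_self (d := d)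
  have hlln := strong_law_ae (μ := P)
    (fun i ω => InnerProductSpace.rankOne ℝ (X i ω) (X i ω)) h.integrable_rankOne
    (fun i j hij => (h.indep_X.indepFun hij).comp hc.measurable hc.measurable)
    (fun i => (h.ident_X i).comp hc.measurable)
  rw [h.integral_rankOne] at hlln
  filter_upwards [hlln] with ω hω
  have h1 := hω.comp hs_top
  -- The discarded sum, divided by `n`, is `s n / n` times an average that converges.
  have h2 := hs_small.tendsto_div_nhds_zero.smul h1
  rw [zero_smul] at h2
  have h3 := hω.sub h2
  rw [sub_zero] at h3
  refine h3.congr' ?_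
  filter_upwards [hs_top.eventually_gt_atTop 0] with n hn
  have hsn : (s n : ℝ) ≠ 0 := by positivity
  simp only [Function.comp, gramOperator, smul_smul, Finset.sum_Ico_eq_sub _ (hs n), smul_sub]
  congr 2
  field_simp

end RandomDesign

end IncidentalRegression

/-! ### Incidental parameters: gaps, score variance, and the leading score -/

namespace IncidentalRegression

/-- The variance factor of the unnormalized estimating equation. -/
noncomputable def scoreVariance (mu : ℕ → ℕ → ℝ) (s₁ s₂ : ℕ → ℕ) (lam : ℕ → ℝ) (σ : ℝ) (n : ℕ) :
    ℝ :=
  lam n ^ 2 * s₁ n + boundedNorm mu s₁ s₂ n ^ 2 + σ ^ 2 * n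

theorem minAbs_le {s : ℕ} {m : ℕ → ℝ} {i : ℕ} (hi : i < s) : minAbs s m ≤ |m i| :=
  ciInf_le (f := fun i : Fin s => |m i|)
    ⟨0, by rintro _ ⟨j, rfl⟩; exact abs_nonneg _⟩ ⟨i, hi⟩

theorem minAbs_nonneg (s : ℕ) (m : ℕ → ℝ) : 0 ≤ minAbs s m :=
  Real.iInf_nonneg fun _ => abs_nonneg _

theorem boundedNorm_sq (mu : ℕ → ℕ → ℝ) (s₁ s₂ : ℕ → ℕ) (n : ℕ) :
    boundedNorm mu s₁ s₂ n ^ 2 = ∑ i ∈ Finset.Ico (s₁ n) (s₁ n + s₂ n), mu n i ^ 2 :=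
  Real.sq_sqrt (Finset.sum_nonneg fun _ _ => sq_nonneg _)

section Regime

variable {mu : ℕ → ℕ → ℝ} {s₁ s₂ : ℕ → ℕ} {κ γ lam : ℕ → ℝ}

theorem RegularizationSpec.two_mul_γ_le (hl : RegularizationSpec mu s₁ κ γ lam)
    (hγ : ∀ n, 0 < γ n) (n : ℕ) : 2 * γ n ≤ lam n := by
  obtain ⟨α, hα, h⟩ := hl.γ_le
  nlinarith [h n, hγ n]

theorem RegularizationSpec.lam_pos (hl : RegularizationSpec mu s₁ κ γ lam)
    (hγ : ∀ n, 0 < γ n) (n : ℕ) : 0 < lam n := by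
  linarith [hl.two_mul_γ_le hγ n, hγ n]

theorem RegularizationSpec.lam_isLittleO (hl : RegularizationSpec mu s₁ κ γ lam) :
    lam =o[atTop] fun n : ℕ => √(n : ℝ) := by
  refine hl.lam_small.trans_isBigO (IsBigO.of_bound 1 (Eventually.of_forall fun n => ?_))
  rw [one_mul, Real.norm_of_nonneg (le_min (minAbs_nonneg _ _) (Real.sqrt_nonneg _)),
    Real.norm_of_nonneg (Real.sqrt_nonneg _)]
  exact min_le_right _ _

/-- The condition `α > 2` leaves room for `κ`: since `γ ≤ lam/α`, the part `2γ` uses up the fraction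
`2/α < 1` of `lam`. For the large parameters, `lam`, `γ` and `κ` are each eventually at most a
quarter of the minimum. -/
theorem eventually_gap (hs : SparseIncidental mu s₁ s₂ κ γ)
    (hl : RegularizationSpec mu s₁ κ γ lam) (hκ : ∀ n, 0 < κ n) (hγ : ∀ n, 0 < γ n) :
    ∀ᶠ n in atTop, 2 * γ n + κ n < lam n ∧ ∀ i < s₁ n, lam n + γ n + κ n ≤ |mu n i| := by
  obtain ⟨α, hα, hαγ⟩ := hl.γ_le
  -- Half of the slack left by `2γ`, so that the final inequality is strict.
  have hc : 0 < (1 - 2 / α) / 2 := by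
    have : 2 / α < 1 := (div_lt_one (by linarith)).2 hα
    linarith
  filter_upwards [hl.κ_small.def hc, hl.lam_small.def (show (0 : ℝ) < 1 / 4 by norm_num),
    hs.large.def (show (0 : ℝ) < 1 / 4 by norm_num)] with n h1 h2 h3
  have hlp := hl.lam_pos hγ n
  have hM := minAbs_nonneg (s₁ n) (mu n)
  rw [Real.norm_of_nonneg (hκ n).le, Real.norm_of_nonneg hlp.le] at h1
  rw [Real.norm_of_nonneg hlp.le, Real.norm_of_nonneg (le_min hM (Real.sqrt_nonneg _))] at h2
  rw [Real.norm_of_nonneg (le_max_of_le_left (hκ n).le), Real.norm_of_nonneg hM] at h3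
  refine ⟨?_, fun i hi => ?_⟩
  · have h4 : γ n ≤ lam n / α := by
      rw [le_div_iff₀ (by linarith)]; linarith [hαγ n]
    have h5 : (1 - 2 / α) / 2 * lam n = lam n / 2 - lam n / α := by ring
    have h6 : 0 < (1 - 2 / α) / 2 * lam n := mul_pos hc hlp
    linarith
  · have h4 := minAbs_le (m := mu n) hi
    have h5 := min_le_left (minAbs (s₁ n) (mu n)) √(n : ℝ)
    have h6 := le_max_left (κ n) (γ n)
    have h7 := le_max_right (κ n) (γ n)
    linarith

/-- Only an inequality, because `m i` may vanish and then `0 / 0 = 0`. Equality returns for large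
`n`, once the first block is bounded away from zero. -/
theorem scoreShift_sq_le (l : ℝ) (s : ℕ) (m : ℕ → ℝ) (i : ℕ) (hi : i < s) :
    scoreShift l s m i ^ 2 ≤ l ^ 2 := by
  simp only [scoreShift, hi, if_true, mul_pow, div_pow, sq_abs]
  exact mul_le_of_le_one_right (sq_nonneg _) (div_self_le_one _)

theorem sum_scoreShift_sq_le (mu : ℕ → ℕ → ℝ) (s₁ s₂ : ℕ → ℕ) (lam : ℕ → ℝ) (n : ℕ) :
    ∑ i ∈ Finset.range (s₁ n + s₂ n), scoreShift (lam n) (s₁ n) (mu n) i ^ 2 ≤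
      lam n ^ 2 * s₁ n + boundedNorm mu s₁ s₂ n ^ 2 := by
  rw [Finset.range_eq_Ico, ← Finset.sum_Ico_consecutive _ (Nat.zero_le (s₁ n)) le_self_add,
    boundedNorm_sq]
  refine add_le_add ?_ (Finset.sum_le_sum fun i hi => ?_)
  · refine (Finset.sum_le_card_nsmul _ _ (lam n ^ 2) fun i hi =>
      scoreShift_sq_le _ _ _ i (Finset.mem_Ico.1 hi).2).trans_eq ?_
    simp [mul_comm]
  · simp [scoreShift, not_lt.2 (Finset.mem_Ico.1 hi).1]

theorem sum_scoreShift_sq_eq (hs : SparseIncidental mu s₁ s₂ κ γ)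
    (hl : RegularizationSpec mu s₁ κ γ lam) (hκ : ∀ n, 0 < κ n) (hγ : ∀ n, 0 < γ n) :
    ∀ᶠ n in atTop, ∑ i ∈ Finset.range (s₁ n + s₂ n), scoreShift (lam n) (s₁ n) (mu n) i ^ 2 =
      lam n ^ 2 * s₁ n + boundedNorm mu s₁ s₂ n ^ 2 := by
  filter_upwards [eventually_gap hs hl hκ hγ] with n hn
  rw [Finset.range_eq_Ico, ← Finset.sum_Ico_consecutive _ (Nat.zero_le (s₁ n)) le_self_add,
    boundedNorm_sq]
  congr 1
  · rw [Finset.sum_congr rfl (g := fun _ => lam n ^ 2) fun i hi => ?_]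
    · simp [mul_comm]
    · have h1 := hn.2 i (Finset.mem_Ico.1 hi).2
      have h2 : mu n i ≠ 0 := abs_pos.1 (by linarith [hκ n, hγ n, hl.lam_pos hγ n])
      simp [scoreShift, (Finset.mem_Ico.1 hi).2, mul_pow, div_pow, div_self (pow_ne_zero 2 h2)]
  · refine Finset.sum_congr rfl fun i hi => ?_
    simp [scoreShift, not_lt.2 (Finset.mem_Ico.1 hi).1]

theorem sum_weights_le (hs : SparseIncidental mu s₁ s₂ κ γ) (σ : ℝ) (n : ℕ) :
    ∑ i ∈ Finset.range n, (scoreShift (lam n) (s₁ n) (mu n) i ^ 2 +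
      scoreNoise (s₁ n) i ^ 2 * σ ^ 2) ≤ scoreVariance mu s₁ s₂ lam σ n := by
  rw [Finset.sum_add_distrib, scoreVariance]
  refine add_le_add ?_ ?_
  · refine le_trans (le_of_eq ?_) (sum_scoreShift_sq_le mu s₁ s₂ lam n)
    rw [Finset.range_eq_Ico, ← Finset.sum_Ico_consecutive _ (Nat.zero_le _) (hs.card_le n),
      ← Finset.range_eq_Ico, add_eq_left]
    refine Finset.sum_eq_zero fun i hi => ?_
    have h1 := (Finset.mem_Ico.1 hi).1
    have h2 : ¬ i < s₁ n := by omega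
    simp [scoreShift, h2, hs.zero n i h1 (Finset.mem_Ico.1 hi).2]
  · refine (Finset.sum_le_card_nsmul _ _ (σ ^ 2) fun i _ => ?_).trans_eq ?_
    · unfold scoreNoise
      split_ifs <;> simp [sq_nonneg]
    · simp [mul_comm]

theorem abs_scoreShift_le (hs : SparseIncidental mu s₁ s₂ κ γ)
    (hl : RegularizationSpec mu s₁ κ γ lam) (hγ : ∀ n, 0 < γ n) (n i : ℕ)
    (hi : i < s₁ n + s₂ n) : |scoreShift (lam n) (s₁ n) (mu n) i| ≤ lam n := by
  by_cases h : i < s₁ n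
  · exact abs_le_of_sq_le_sq (scoreShift_sq_le _ _ _ i h) (hl.lam_pos hγ n).le
  · have h1 := (hs.bounded n i (not_lt.1 h) hi).2
    simp only [scoreShift, h, if_false]
    linarith [hl.two_mul_γ_le hγ n, hγ n]

theorem boundedNorm_sq_le (hs : SparseIncidental mu s₁ s₂ κ γ) (n : ℕ) :
    boundedNorm mu s₁ s₂ n ^ 2 ≤ s₂ n * γ n ^ 2 := by
  rw [boundedNorm_sq]
  refine (Finset.sum_le_card_nsmul _ _ (γ n ^ 2) fun i hi => ?_).trans_eq ?_
  · rw [← sq_abs]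
    exact pow_le_pow_left₀ (abs_nonneg _)
      (hs.bounded n i (Finset.mem_Ico.1 hi).1 (Finset.mem_Ico.1 hi).2).2 2
  · simp

theorem isLittleO_sq_of_sqrt {f : ℕ → ℝ} (hf : f =o[atTop] fun n : ℕ => √(n : ℝ)) :
    (fun n => f n ^ 2) =o[atTop] fun n : ℕ => (n : ℝ) :=
  (hf.pow two_pos).congr_right fun n => Real.sq_sqrt (Nat.cast_nonneg n)

/-- With Chebyshev's inequality this gives smallness of the unscaled score, the input to the KKT
verification. Each term is `o(n²)`: `lam²` and `γ²` are `o(n)`, and so are the block sizes. -/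
theorem tendsto_scoreVariance_div (hs : SparseIncidental mu s₁ s₂ κ γ)
    (hl : RegularizationSpec mu s₁ κ γ lam)
    (hγs : γ =o[atTop] fun n : ℕ => √(n : ℝ)) (σ : ℝ) :
    Tendsto (fun n : ℕ => (1 / (n : ℝ)) ^ 2 * scoreVariance mu s₁ s₂ lam σ n) atTop (𝓝 0) := by
  have h1 : (fun n => lam n ^ 2 * (s₁ n : ℝ)) =o[atTop] fun n : ℕ => (n : ℝ) * n :=
    (isLittleO_sq_of_sqrt hl.lam_isLittleO).mul hs.s₁_small
  have h2 : (fun n => boundedNorm mu s₁ s₂ n ^ 2) =o[atTop] fun n : ℕ => (n : ℝ) * n := by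
    refine IsBigO.trans_isLittleO (IsBigO.of_bound 1 (Eventually.of_forall fun n => ?_))
      (hs.s₂_small.mul (isLittleO_sq_of_sqrt hγs))
    rw [one_mul, Real.norm_of_nonneg (sq_nonneg _), Real.norm_of_nonneg (by positivity)]
    exact boundedNorm_sq_le hs n
  have h3 : (fun n : ℕ => σ ^ 2 * (n : ℝ)) =o[atTop] fun n : ℕ => (n : ℝ) * n := by
    have : (fun _ : ℕ => σ ^ 2) =o[atTop] fun n : ℕ => (n : ℝ) :=
      isLittleO_const_left.2 (Or.inr (tendsto_norm_atTop_atTop.comp tendsto_natCast_atTop_atTop))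
    exact this.mul_isBigO (isBigO_refl _ _)
  refine ((h1.add h2).add h3).tendsto_div_nhds_zero.congr fun n => ?_
  rw [scoreVariance, one_div, inv_pow, ← sq, div_eq_inv_mul]

/-- The leading part of the rescaled score: the errors attached to bounded nonzero incidental
parameters are dropped. -/
noncomputable def mainScore {Ω : Type*} {d : ℕ} (X : ℕ → Ω → Vec d) (ε : ℕ → Ω → ℝ) (mu : ℕ → ℕ → ℝ) (s₁ s₂ : ℕ → ℕ)
    (lam r : ℕ → ℝ) (n : ℕ) (ω : Ω) : Vec d :=
  ∑ i ∈ Finset.range (s₁ n + s₂ n), (r n / n * scoreShift (lam n) (s₁ n) (mu n) i) • X i ω +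
    ∑ i ∈ Finset.Ico (s₁ n + s₂ n) n, (r n / n * ε i ω) • X i ω

/-- Without the errors of the bounded block, each summand is a deterministic multiple of `X i` or of
`ε i • X i`, the form the central limit theorem accepts. -/
theorem smul_normalizedScore_eq {Ω : Type*} {d : ℕ} {X : ℕ → Ω → Vec d} {ε : ℕ → Ω → ℝ}
    (hs : SparseIncidental mu s₁ s₂ κ γ) (r : ℕ → ℝ) (n : ℕ) (ω : Ω) :
    r n • normalizedScore (lam n) (s₁ n) (mu n) (fun i => X i ω) (fun i => ε i ω) n =
      mainScore X ε mu s₁ s₂ lam r n ω +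
      ∑ i ∈ Finset.Ico (s₁ n) (s₁ n + s₂ n), (r n / n * ε i ω) • X i ω := by
  rw [normalizedScore, smul_smul, ← div_eq_mul_inv, mainScore, Finset.smul_sum,
    Finset.range_eq_Ico, Finset.range_eq_Ico,
    ← Finset.sum_Ico_consecutive _ (Nat.zero_le _) (hs.card_le n),
    ← Finset.sum_Ico_consecutive _ (Nat.zero_le (s₁ n)) (le_self_add (b := s₂ n)),
    ← Finset.sum_Ico_consecutive (fun i => (r n / n * scoreShift (lam n) (s₁ n) (mu n) i) • X i ω)
      (Nat.zero_le (s₁ n)) (le_self_add (b := s₂ n))]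
  have h1 : ∑ i ∈ Finset.Ico 0 (s₁ n), (r n / (n : ℝ)) • (scoreShift (lam n) (s₁ n) (mu n) i +
      scoreNoise (s₁ n) i * ε i ω) • X i ω = ∑ i ∈ Finset.Ico 0 (s₁ n),
      (r n / n * scoreShift (lam n) (s₁ n) (mu n) i) • X i ω := by
    refine Finset.sum_congr rfl fun i hi => ?_
    simp [scoreNoise, (Finset.mem_Ico.1 hi).2, smul_smul]
  have h2 : ∑ i ∈ Finset.Ico (s₁ n) (s₁ n + s₂ n), (r n / (n : ℝ)) •
      (scoreShift (lam n) (s₁ n) (mu n) i + scoreNoise (s₁ n) i * ε i ω) • X i ω =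
      ∑ i ∈ Finset.Ico (s₁ n) (s₁ n + s₂ n),
        (r n / n * scoreShift (lam n) (s₁ n) (mu n) i) • X i ω +
      ∑ i ∈ Finset.Ico (s₁ n) (s₁ n + s₂ n), (r n / n * ε i ω) • X i ω := by
    rw [← Finset.sum_add_distrib]
    refine Finset.sum_congr rfl fun i hi => ?_
    simp [scoreNoise, not_lt.2 (Finset.mem_Ico.1 hi).1, smul_smul, add_smul]
  have h3 : ∑ i ∈ Finset.Ico (s₁ n + s₂ n) n, (r n / (n : ℝ)) •
      (scoreShift (lam n) (s₁ n) (mu n) i + scoreNoise (s₁ n) i * ε i ω) • X i ω =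
      ∑ i ∈ Finset.Ico (s₁ n + s₂ n) n, (r n / n * ε i ω) • X i ω := by
    refine Finset.sum_congr rfl fun i hi => ?_
    have h4 := (Finset.mem_Ico.1 hi).1
    have h5 : ¬ i < s₁ n := by omega
    simp [scoreNoise, scoreShift, h5, hs.zero n i h4 (Finset.mem_Ico.1 hi).2, smul_smul]
  rw [h1, h2, h3]
  abel

end Regime

namespace RandomDesign

variable {Ω : Type*} [MeasurableSpace Ω] {P : Measure Ω} {d : ℕ}
  {X : ℕ → Ω → Vec d} {ε : ℕ → Ω → ℝ} {σ : ℝ}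
  {mu : ℕ → ℕ → ℝ} {s₁ s₂ : ℕ → ℕ} {κ γ lam : ℕ → ℝ}

theorem measurable_mainScore (h : RandomDesign P X ε σ) (r : ℕ → ℝ) (n : ℕ) :
    Measurable (mainScore X ε mu s₁ s₂ lam r n) := by
  have mX := h.measurable_X
  have mε := h.measurable_ε
  unfold mainScore
  fun_prop

variable [IsProbabilityMeasure P]

theorem measureReal_smul_score_le (h : RandomDesign P X ε σ)
    (hs : SparseIncidental mu s₁ s₂ κ γ) (n : ℕ) (ρ : ℝ) {K : ℝ} (hK : 0 < K) :
    P.real {ω | K ≤ ‖ρ • ∑ i ∈ Finset.range n, (scoreShift (lam n) (s₁ n) (mu n) i +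
      scoreNoise (s₁ n) i * ε i ω) • X i ω‖} ≤
      ρ ^ 2 * scoreVariance mu s₁ s₂ lam σ n * (∫ ω, ‖X 0 ω‖ ^ 2 ∂P) / K ^ 2 := by
  have h1 := h.measureReal_sum_score_le (Finset.range n)
    (fun i => ρ * scoreShift (lam n) (s₁ n) (mu n) i) (fun i => ρ * scoreNoise (s₁ n) i) hK
  have h2 : ∀ ω, ∑ i ∈ Finset.range n, (ρ * scoreShift (lam n) (s₁ n) (mu n) i +
      ρ * scoreNoise (s₁ n) i * ε i ω) • X i ω = ρ • ∑ i ∈ Finset.range n,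
      (scoreShift (lam n) (s₁ n) (mu n) i + scoreNoise (s₁ n) i * ε i ω) • X i ω := fun ω => by
    rw [Finset.smul_sum]
    refine Finset.sum_congr rfl fun i _ => ?_
    rw [smul_smul]
    congr 1; ring
  simp_rw [h2] at h1
  refine h1.trans ?_
  have h3 : ∑ i ∈ Finset.range n, ((ρ * scoreShift (lam n) (s₁ n) (mu n) i) ^ 2 +
      (ρ * scoreNoise (s₁ n) i) ^ 2 * σ ^ 2) ≤ ρ ^ 2 * scoreVariance mu s₁ s₂ lam σ n := by
    refine le_trans (le_of_eq ?_)
      (mul_le_mul_of_nonneg_left (sum_weights_le (lam := lam) hs σ n) (sq_nonneg ρ))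
    rw [Finset.mul_sum]
    exact Finset.sum_congr rfl fun i _ => by ring
  have h4 : 0 ≤ ∫ ω, ‖X 0 ω‖ ^ 2 ∂P := integral_nonneg fun _ => sq_nonneg _
  gcongr

theorem measureReal_sum_noise_le (h : RandomDesign P X ε σ) (s : Finset ℕ) (ρ : ℝ) {K : ℝ}
    (hK : 0 < K) :
    P.real {ω | K ≤ ‖∑ i ∈ s, (ρ * ε i ω) • X i ω‖} ≤
      s.card * ρ ^ 2 * σ ^ 2 * (∫ ω, ‖X 0 ω‖ ^ 2 ∂P) / K ^ 2 := by
  have := h.measureReal_sum_score_le s (fun _ => 0) (fun _ => ρ) hK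
  simpa [mul_assoc] using this

/-- The leading part of the rescaled score is asymptotically Gaussian. -/
theorem tendsto_charFun_mainScore (h : RandomDesign P X ε σ) (hm : MaximalBounds P X ε κ γ)
    (hs : SparseIncidental mu s₁ s₂ κ γ) (hl : RegularizationSpec mu s₁ κ γ lam)
    {r : ℕ → ℝ} (hr : r =O[atTop] fun n : ℕ => √(n : ℝ)) {τ : ℝ}
    (hτ : Tendsto (fun n : ℕ => (r n / n) ^ 2 * scoreVariance mu s₁ s₂ lam σ n) atTop (𝓝 τ))
    (u : Vec d) :
    Tendsto (fun n : ℕ => charFun (P.map (mainScore X ε mu s₁ s₂ lam r n)) u) atTop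
      (𝓝 (Complex.exp (-(τ * (∫ ω, inner ℝ (X 0 ω) u ^ 2 ∂P) / 2 : ℝ)))) := by
  have hsq : (fun n => r n ^ 2) =O[atTop] fun n : ℕ => (n : ℝ) :=
    (hr.pow 2).congr_right fun n => Real.sq_sqrt (Nat.cast_nonneg n)
  have hsqrt : (fun n : ℕ => √(n : ℝ) * √(n : ℝ)) = fun n : ℕ => (n : ℝ) :=
    funext fun n => Real.mul_self_sqrt (Nat.cast_nonneg n)
  have hone : (fun _ : ℕ => (1 : ℝ)) =o[atTop] fun n : ℕ => √(n : ℝ) :=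
    isLittleO_const_left.2 (Or.inr (tendsto_norm_atTop_atTop.comp
      (Real.tendsto_sqrt_atTop.comp tendsto_natCast_atTop_atTop)))
  have hρ : Tendsto (fun n : ℕ => r n / (n : ℝ)) atTop (𝓝 0) := by
    have := hr.mul_isLittleO hone
    rw [hsqrt] at this
    simpa using this.tendsto_div_nhds_zero
  have hρl : Tendsto (fun n : ℕ => r n * lam n / (n : ℝ)) atTop (𝓝 0) := by
    have := hr.mul_isLittleO hl.lam_isLittleO
    rw [hsqrt] at this
    exact this.tendsto_div_nhds_zero
  obtain ⟨K, hK⟩ := hsq.bound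
  -- `scoreVariance` counts `n` errors, the leading score only `n - s₁ - s₂`; the discrepancy is
  -- negligible.
  have hweight : Tendsto (fun n : ℕ => (r n / n) ^ 2 * (s₁ n + s₂ n) * σ ^ 2) atTop (𝓝 0) := by
    have h1 := (hsq.mul_isLittleO (hs.s₁_small.add hs.s₂_small)).tendsto_div_nhds_zero
    have h2 := h1.mul_const (σ ^ 2)
    rw [zero_mul] at h2
    refine h2.congr fun n => ?_
    rw [div_pow, ← sq]
    ring
  refine h.tendsto_charFun_weighted (fun n => s₁ n + s₂ n) hs.card_le
    (fun n i => r n / n * scoreShift (lam n) (s₁ n) (mu n) i) (fun n => r n / n)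
    (fun η hη => ?_) hρ (K := K) ?_ ?_ u
  · filter_upwards [(tendsto_order.1 hρl.abs).2 η (by simpa using hη)] with n hn i hi
    refine lt_of_le_of_lt ?_ hn
    rw [abs_mul, mul_div_right_comm, abs_mul, abs_of_pos (hl.lam_pos hm.γ_pos n)]
    exact mul_le_mul_of_nonneg_left (abs_scoreShift_le hs hl hm.γ_pos n i (Finset.mem_range.1 hi))
      (abs_nonneg _)
  · filter_upwards [hK, eventually_gt_atTop 0] with n hn hn0
    have hn1 : (0 : ℝ) < n := by exact_mod_cast hn0
    rw [Real.norm_of_nonneg (sq_nonneg _), Real.norm_of_nonneg hn1.le] at hn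
    rw [div_pow, mul_div_assoc', div_le_iff₀ (by positivity)]
    nlinarith
  · have h1 := hτ.sub hweight
    rw [sub_zero] at h1
    refine h1.congr' ?_
    filter_upwards [sum_scoreShift_sq_eq hs hl hm.κ_pos hm.γ_pos] with n hn
    simp_rw [mul_pow]
    rw [← Finset.mul_sum, hn, scoreVariance]
    push_cast
    ring

end RandomDesign

end IncidentalRegression

/-! ### Asymptotic normality at a general rate -/

namespace IncidentalRegression

variable {Ω : Type*} [MeasurableSpace Ω] {P : Measure Ω} {d : ℕ}
  {X : ℕ → Ω → Vec d} {ε : ℕ → Ω → ℝ} {σ : ℝ}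
  {mu : ℕ → ℕ → ℝ} {s₁ s₂ : ℕ → ℕ} {κ γ lam : ℕ → ℝ}
  {βstar : Vec d} {βhat : ℕ → Ω → Vec d}

/-- The inverse of the population Gram operator. -/
noncomputable def precisionOperator (P : Measure Ω) (X : ℕ → Ω → Vec d) : Vec d →L[ℝ] Vec d :=
  Matrix.toEuclideanCLM (𝕜 := ℝ) (covMatrix P (X 0))⁻¹

theorem tendsto_measureReal_zero {E : ℕ → Set Ω} (h : Tendsto (fun n => P (E n)) atTop (𝓝 0)) :
    Tendsto (fun n => P.real (E n)) atTop (𝓝 0) := by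
  simpa [Measure.real, Function.comp_def] using
    (ENNReal.tendsto_toReal ENNReal.zero_ne_top).comp h

theorem RandomDesign.precisionOperator_mul (h : RandomDesign P X ε σ) :
    precisionOperator P X * Matrix.toEuclideanCLM (𝕜 := ℝ) (covMatrix P (X 0)) = 1 := by
  rw [precisionOperator, ← map_mul, Matrix.nonsing_inv_mul _ h.posDef_X.det_pos.ne'.isUnit, map_one]

theorem RandomDesign.inner_precisionOperator (h : RandomDesign P X ε σ) (x y : Vec d) :
    inner ℝ (precisionOperator P X x) y = inner ℝ x (precisionOperator P X y) := by
  have h1 : star (precisionOperator P X) = precisionOperator P X := by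
    rw [precisionOperator, ← map_star, Matrix.star_eq_conjTranspose, h.posDef_X.inv.isHermitian.eq]
  rw [ContinuousLinearMap.star_eq_adjoint] at h1
  conv_lhs => rw [← h1]
  exact ContinuousLinearMap.adjoint_inner_left _ _ _

variable [IsProbabilityMeasure P]

/-- The sandwich `Σ⁻¹ Σ Σ⁻¹` collapses to `Σ⁻¹`, the covariance shape of every limit. -/
theorem RandomDesign.integral_inner_precision_sq (h : RandomDesign P X ε σ) (t : Vec d) :
    ∫ ω, inner ℝ (X 0 ω) (precisionOperator P X t) ^ 2 ∂P =
      inner ℝ t (precisionOperator P X t) := by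
  rw [h.integral_inner_sq, h.inner_precisionOperator]
  have := congrArg (fun L : Vec d →L[ℝ] Vec d => L (precisionOperator P X t))
    h.precisionOperator_mul
  simp only [mul_apply_eq_comp, one_apply_eq_self] at this
  rw [this]

theorem RandomDesign.tendstoInDistribution_mainScore (h : RandomDesign P X ε σ)
    (hm : MaximalBounds P X ε κ γ)
    (hs : SparseIncidental mu s₁ s₂ κ γ) (hl : RegularizationSpec mu s₁ κ γ lam)
    {r : ℕ → ℝ} (hr : r =O[atTop] fun n : ℕ => √(n : ℝ)) {τ : ℝ} (hτ0 : 0 ≤ τ)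
    (hτ : Tendsto (fun n : ℕ => (r n / n) ^ 2 * scoreVariance mu s₁ s₂ lam σ n) atTop (𝓝 τ)) :
    TendstoInDistribution
      (fun n ω => precisionOperator P X (mainScore X ε mu s₁ s₂ lam r n ω)) atTop
      (fun z : Vec d => z) (fun _ => P)
      (multivariateGaussian (0 : Vec d) (τ • (covMatrix P (X 0))⁻¹)) where
  forall_aemeasurable n := ((precisionOperator P X).measurable.comp
    (h.measurable_mainScore r n)).aemeasurable
  tendsto := by
    refine ProbabilityMeasure.tendsto_iff_tendsto_charFun.2 fun t => ?_
    have hpos : (τ • (covMatrix P (X 0))⁻¹).PosSemidef := h.posDef_X.inv.posSemidef.smul hτ0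
    have h1 := h.tendsto_charFun_mainScore hm hs hl hr hτ (precisionOperator P X t)
    rw [h.integral_inner_precision_sq] at h1
    have h2 : ∀ n, charFun (P.map fun ω =>
        precisionOperator P X (mainScore X ε mu s₁ s₂ lam r n ω)) t =
        charFun (P.map (mainScore X ε mu s₁ s₂ lam r n)) (precisionOperator P X t) := fun n => by
      have hmeas := h.measurable_mainScore (mu := mu) (s₁ := s₁) (s₂ := s₂) (lam := lam) r n
      rw [charFun_apply, charFun_apply,
        integral_map (by fun_prop) (by fun_prop),
        integral_map hmeas.aemeasurable (by fun_prop)]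
      simp_rw [h.inner_precisionOperator]
    simp only [ProbabilityMeasure.coe_mk, Measure.map_id', h2]
    rw [charFun_multivariateGaussian hpos]
    refine h1.trans_eq ?_
    congr 2
    rw [Matrix.smul_mulVec, dotProduct_smul]
    simp [precisionOperator, EuclideanSpace.inner_eq_star_dotProduct, dotProduct_comm]

/-- Almost sure convergence of the Gram operator, multiplied by the inverse of its limit and
weakened to convergence in probability. -/
theorem RandomDesign.tendsto_measureReal_gram (h : RandomDesign P X ε σ)
    (hs : SparseIncidental mu s₁ s₂ κ γ) {δ : ℝ} (hδ : 0 < δ) :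
    Tendsto (fun n => P.real {ω | δ ≤ ‖1 - precisionOperator P X *
      gramOperator (s₁ n) (fun i => X i ω) n‖}) atTop (𝓝 0) := by
  have hmeas : ∀ n, Measurable fun ω => gramOperator (s₁ n) (fun i => X i ω) n := fun n => by
    have := h.measurable_rankOne
    unfold gramOperator
    fun_prop
  have hae : ∀ᵐ ω ∂P, Tendsto (fun n => 1 - precisionOperator P X *
      gramOperator (s₁ n) (fun i => X i ω) n) atTop (𝓝 0) := by
    filter_upwards [h.tendsto_gramOperator (fun n => le_self_add.trans (hs.card_le n))
      hs.s₁_tendsto hs.s₁_small] with ω hω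
    have := (hω.const_mul (precisionOperator P X)).const_sub 1
    rwa [h.precisionOperator_mul, sub_self] at this
  have hcont : Continuous fun A : Vec d →L[ℝ] Vec d => 1 - precisionOperator P X * A := by fun_prop
  have := tendstoInMeasure_of_tendsto_ae
    (fun n => (hcont.measurable.comp (hmeas n)).aestronglyMeasurable) hae
  simpa using tendstoInMeasure_iff_measureReal_norm.1 this δ hδ

/-- The rescaled estimation error is, up to a term tending to zero in probability, the image of
the leading part of the score. -/
theorem tendstoInMeasure_scaledError_sub (h : RandomDesign P X ε σ)
    (hm : MaximalBounds P X ε κ γ)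
    (hs : SparseIncidental mu s₁ s₂ κ γ) (hl : RegularizationSpec mu s₁ κ γ lam)
    (he : IsOneStepEstimator P X ε mu βstar lam βhat)
    {r : ℕ → ℝ} (hr : r =O[atTop] fun n : ℕ => √(n : ℝ)) {τ : ℝ}
    (hτ : Tendsto (fun n : ℕ => (r n / n) ^ 2 * scoreVariance mu s₁ s₂ lam σ n) atTop (𝓝 τ)) :
    TendstoInMeasure P ((fun n ω => r n • (βhat n ω - βstar)) -
      fun n ω => precisionOperator P X (mainScore X ε mu s₁ s₂ lam r n ω)) atTop 0 := by
  rw [tendstoInMeasure_iff_measureReal_norm]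
  intro η hη
  simp only [Pi.sub_apply, Pi.zero_apply, sub_zero]
  set G := precisionOperator P X with hGdef
  set g : ℝ := ‖G‖ + 1 with hg
  have hg0 : 0 < g := by positivity
  have hGg : ‖G‖ ≤ g := by linarith
  set M := ∫ ω, ‖X 0 ω‖ ^ 2 ∂P with hM
  have hM0 : 0 ≤ M := integral_nonneg fun _ => sq_nonneg _
  set score : ℕ → Ω → Vec d := fun n ω =>
    normalizedScore (lam n) (s₁ n) (mu n) (fun i => X i ω) (fun i => ε i ω) n with hscore
  set rem : ℕ → Ω → Vec d := fun n ω =>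
    ∑ i ∈ Finset.Ico (s₁ n) (s₁ n + s₂ n), (r n / n * ε i ω) • X i ω with hrem
  have hbound : ∀ n (ρ : ℝ) {K : ℝ}, 0 < K → P.real {ω | K ≤ ‖ρ • score n ω‖} ≤
      (ρ / n) ^ 2 * scoreVariance mu s₁ s₂ lam σ n * M / K ^ 2 := fun n ρ K hK => by
    have := h.measureReal_smul_score_le (lam := lam) hs n (ρ / n) hK
    simpa only [hscore, normalizedScore, smul_smul, div_eq_mul_inv] using this
  rw [tendsto_order]
  refine ⟨fun a ha => Eventually.of_forall fun n => ha.trans_le measureReal_nonneg,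
    fun e hpos => ?_⟩
  -- `K` bounds the rescaled score outside probability `e/2`. Then `‖y‖ ≤ 2gK`, so `δ` makes the
  -- Gram error at most `η/4`, and `ν` does the same for the dropped errors. The value `θ = 1/(2g)`
  -- is what the bound `‖θ‖ ≤ 1` on the linear solution requires. The other six exceptional events
  -- share the remaining `e/2`.
  obtain ⟨K, hK, hKe⟩ : ∃ K : ℝ, 0 < K ∧ (τ + 1) * M / K ^ 2 < e / 2 := by
    have : Tendsto (fun K : ℝ => (τ + 1) * M / K ^ 2) atTop (𝓝 0) :=
      tendsto_const_nhds.div_atTop (tendsto_pow_atTop two_ne_zero)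
    exact ((eventually_gt_atTop 0).and
      ((tendsto_order.1 this).2 _ (half_pos hpos))).exists
  set δ : ℝ := min (1 / 2) (η / (8 * g * K)) with hδ
  have hδ0 : 0 < δ := lt_min (by norm_num) (by positivity)
  set θ : ℝ := 1 / (2 * g) with hθ
  have hθ0 : 0 < θ := by positivity
  set ν : ℝ := η / (4 * g) with hν
  have hν0 : 0 < ν := by positivity
  have hE1 := tendsto_measureReal_zero he.minimizes
  have hE2 := tendsto_measureReal_zero hm.max_X
  have hE3 := tendsto_measureReal_zero hm.max_ε
  have hE4 := h.tendsto_measureReal_gram hs hδ0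
  have hE5 : Tendsto (fun n => P.real {ω | θ ≤ ‖score n ω‖}) atTop (𝓝 0) := by
    have h1 := ((tendsto_scoreVariance_div hs hl hm.γ_small σ).mul_const M).div_const (θ ^ 2)
    rw [zero_mul, zero_div] at h1
    refine squeeze_zero (fun n => measureReal_nonneg) (fun n => ?_) h1
    simpa using hbound n 1 hθ0
  have hE6 : Tendsto (fun n => P.real {ω | ν ≤ ‖rem n ω‖}) atTop (𝓝 0) := by
    have hsq : (fun n => r n ^ 2) =O[atTop] fun n : ℕ => (n : ℝ) :=
      (hr.pow 2).congr_right fun n => Real.sq_sqrt (Nat.cast_nonneg n)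
    have h1 := (((hsq.mul_isLittleO hs.s₂_small).tendsto_div_nhds_zero.mul_const
      (σ ^ 2)).mul_const M).div_const (ν ^ 2)
    simp only [zero_mul, zero_div] at h1
    refine squeeze_zero (fun n => measureReal_nonneg) (fun n => ?_) h1
    refine (h.measureReal_sum_noise_le _ _ hν0).trans_eq ?_
    simp only [Nat.card_Ico, add_tsub_cancel_left, div_pow, ← sq]
    ring
  have hsum := ((((hE1.add hE2).add hE3).add hE4).add hE5).add hE6
  simp only [add_zero] at hsum
  filter_upwards [(tendsto_order.1 hsum).2 _ (half_pos hpos),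
    (tendsto_order.1 hτ).2 (τ + 1) (by linarith),
    eventually_gap hs hl hm.κ_pos hm.γ_pos] with n hn hτn hgap
  have hE7 : P.real {ω | K ≤ ‖r n • score n ω‖} < e / 2 := by
    refine ((hbound n (r n) hK).trans ?_).trans_lt hKe
    gcongr
  have hsub : {ω | η ≤ ‖r n • (βhat n ω - βstar) - G (mainScore X ε mu s₁ s₂ lam r n ω)‖} ⊆
      ((((({ω | ¬ IsPenalizedEstimate (lam n) (fun i : Fin n => X i ω)
        (response X ε mu βstar n ω) (βhat n ω)} ∪ {ω | ∃ i < n, κ n < ‖X i ω‖}) ∪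
        {ω | ∃ i < n, γ n < |ε i ω|}) ∪
        {ω | δ ≤ ‖1 - G * gramOperator (s₁ n) (fun i => X i ω) n‖}) ∪
        {ω | θ ≤ ‖score n ω‖}) ∪ {ω | ν ≤ ‖rem n ω‖}) ∪ {ω | K ≤ ‖r n • score n ω‖} := by
    intro ω hω
    by_contra hcon
    simp only [Set.mem_union, Set.mem_ofPred_eq, not_or, not_exists, not_and, not_lt, not_le,
      not_not] at hcon hω
    obtain ⟨⟨⟨⟨⟨⟨c1, c2⟩, c3⟩, c4⟩, c5⟩, c6⟩, c7⟩ := hcon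
    have c4' : ‖1 - G * gramOperator (s₁ n) (fun i => X i ω) n‖ ≤ 1 / 2 :=
      c4.le.trans (min_le_left _ _)
    have hGs : ‖G‖ * ‖score n ω‖ ≤ g * θ := by gcongr
    have hgθ : g * θ = 1 / 2 := by rw [hθ]; field_simp
    have heq := gramOperator_estimate_eq (le_self_add.trans (hs.card_le n))
      (hl.lam_pos hm.γ_pos n) (hm.γ_pos n) (hm.κ_pos n) hgap.1 c2 c3 hgap.2
      (fun i hi hsi => by
        rcases lt_or_ge i (s₁ n + s₂ n) with h1 | h1
        · exact (hs.bounded n i hsi h1).2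
        · rw [hs.zero n i h1 hi, abs_zero]; exact (hm.γ_pos n).le)
      c4' (show 2 * (‖G‖ * ‖score n ω‖) ≤ 1 by linarith) c1
    set A := gramOperator (s₁ n) (fun i => X i ω) n with hA
    set y := r n • (βhat n ω - βstar) with hy
    have hAy : A y = r n • score n ω := by rw [hy, map_smul, heq]
    have hy1 : ‖y‖ ≤ 2 * (g * K) := by
      refine (norm_le_of_approx_inverse c4' y).trans ?_
      rw [hAy]
      have := G.le_opNorm (r n • score n ω)
      have : ‖G‖ * ‖r n • score n ω‖ ≤ g * K := by gcongr
      linarith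
    -- Since `A y` is the rescaled score, writing `y = G (A y) + (1 - G A) y` isolates the dropped
    -- errors and the Gram error.
    have hdecomp : y - G (mainScore X ε mu s₁ s₂ lam r n ω) = G (rem n ω) + (1 - G * A) y := by
      have h1 : r n • score n ω = mainScore X ε mu s₁ s₂ lam r n ω + rem n ω :=
        smul_normalizedScore_eq hs r n ω
      have h2 : (1 - G * A) y = y - G (A y) := by simp
      rw [h2, hAy, h1, map_add]
      abel
    have h1 : ‖G (rem n ω)‖ ≤ g * ν := (G.le_opNorm _).trans (by gcongr)
    have h2 : ‖(1 - G * A) y‖ ≤ η / (8 * g * K) * (2 * (g * K)) :=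
      ((1 - G * A).le_opNorm y).trans
        (mul_le_mul (c4.le.trans (min_le_right _ _)) hy1 (norm_nonneg _) (by positivity))
    have h3 : g * ν = η / 4 := by rw [hν]; field_simp
    have h4 : η / (8 * g * K) * (2 * (g * K)) = η / 4 := by field_simp; norm_num
    have h5 := norm_add_le (G (rem n ω)) ((1 - G * A) y)
    rw [hdecomp] at hω
    linarith
  refine (measureReal_mono hsub).trans_lt ?_
  refine (measureReal_union_le _ _).trans_lt ?_
  have u1 := measureReal_union_le (μ := P) {ω | ¬ IsPenalizedEstimate (lam n)
    (fun i : Fin n => X i ω) (response X ε mu βstar n ω) (βhat n ω)} {ω | ∃ i < n, κ n < ‖X i ω‖}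
  refine lt_of_le_of_lt (add_le_add_left ((measureReal_union_le _ _).trans (add_le_add_left
    ((measureReal_union_le _ _).trans (add_le_add_left ((measureReal_union_le _ _).trans
      (add_le_add_left ((measureReal_union_le _ _).trans (add_le_add_left u1 _)) _)) _)) _)) _) ?_
  linarith

/-- Asymptotic normality of the one-step estimator at any rate balancing the score variance. -/
theorem scaledErrorTendsto_of_rate (h : RandomDesign P X ε σ)
    (hm : MaximalBounds P X ε κ γ)
    (hs : SparseIncidental mu s₁ s₂ κ γ) (hl : RegularizationSpec mu s₁ κ γ lam)
    (he : IsOneStepEstimator P X ε mu βstar lam βhat)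
    {r : ℕ → ℝ} (hr : r =O[atTop] fun n : ℕ => √(n : ℝ)) {τ : ℝ} (hτ0 : 0 ≤ τ)
    (hτ : Tendsto (fun n : ℕ => (r n / n) ^ 2 * scoreVariance mu s₁ s₂ lam σ n) atTop (𝓝 τ)) :
    ScaledErrorTendsto P r βhat βstar (τ • (covMatrix P (X 0))⁻¹) :=
  tendstoInDistribution_of_tendstoInMeasure_sub _ _
    (h.tendstoInDistribution_mainScore hm hs hl hr hτ0 hτ)
    (tendstoInMeasure_scaledError_sub h hm hs hl he hr hτ)
    fun n => ((he.aemeasurable n).sub_const βstar).const_smul (r n)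

end IncidentalRegression

/-! ### Rate computations: which term of the score variance dominates -/

namespace IncidentalRegression

section Rates

variable {mu : ℕ → ℕ → ℝ} {s₁ s₂ : ℕ → ℕ} {κ γ lam : ℕ → ℝ} {σ : ℝ}

theorem isLittleO_sqrt_of_sq_div {f : ℕ → ℝ}
    (hf : Tendsto (fun n : ℕ => f n ^ 2 / n) atTop (𝓝 0)) :
    f =o[atTop] fun n : ℕ => √(n : ℝ) := by
  refine isLittleO_of_tendsto' ?_ ?_
  · filter_upwards [eventually_gt_atTop 0] with n hn h0
    have : 0 < √(n : ℝ) := Real.sqrt_pos.2 (by exact_mod_cast hn)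
    exact absurd h0 this.ne'
  · have h1 := hf.sqrt
    rw [Real.sqrt_zero] at h1
    rw [tendsto_zero_iff_norm_tendsto_zero]
    refine h1.congr fun n => ?_
    rw [Real.sqrt_div (sq_nonneg _), Real.sqrt_sq_eq_abs, norm_div, Real.norm_eq_abs,
      Real.norm_of_nonneg (Real.sqrt_nonneg _)]

theorem tendsto_rate_congr {r f V : ℕ → ℝ} (hrf : r ~[atTop] f) {τ : ℝ}
    (hf : Tendsto (fun n : ℕ => (f n / n) ^ 2 * V n) atTop (𝓝 τ)) :
    Tendsto (fun n : ℕ => (r n / n) ^ 2 * V n) atTop (𝓝 τ) := by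
  have h1 : (fun n : ℕ => (r n / n) ^ 2 * V n) ~[atTop] fun n : ℕ => (f n / n) ^ 2 * V n :=
    ((hrf.div IsEquivalent.refl).pow 2).mul IsEquivalent.refl
  exact h1.symm.tendsto_nhds hf

theorem tendsto_rate_sqrt {p q : ℝ}
    (ha : Tendsto (fun n : ℕ => lam n ^ 2 * s₁ n / n) atTop (𝓝 p))
    (hd : Tendsto (fun n : ℕ => boundedNorm mu s₁ s₂ n ^ 2 / n) atTop (𝓝 q)) :
    Tendsto (fun n : ℕ => (√(n : ℝ) / n) ^ 2 * scoreVariance mu s₁ s₂ lam σ n) atTop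
      (𝓝 (p + q + σ ^ 2)) := by
  refine ((ha.add hd).add_const (σ ^ 2)).congr' ?_
  filter_upwards [eventually_gt_atTop 0] with n hn
  have hn' : (n : ℝ) ≠ 0 := by positivity
  rw [div_pow, Real.sq_sqrt (Nat.cast_nonneg n), scoreVariance]
  field_simp

/-- At rate `n / D` the factor `(r/n)²` is `1 / D²`, so the noise term `σ² n / D²` vanishes. -/
theorem tendsto_rate_boundedNorm
    (hd : Tendsto (fun n : ℕ => boundedNorm mu s₁ s₂ n ^ 2 / n) atTop atTop) {q : ℝ}
    (hq : Tendsto (fun n : ℕ => lam n ^ 2 * s₁ n / boundedNorm mu s₁ s₂ n ^ 2) atTop (𝓝 q)) :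
    Tendsto (fun n : ℕ => ((n : ℝ) / boundedNorm mu s₁ s₂ n / n) ^ 2 *
      scoreVariance mu s₁ s₂ lam σ n) atTop (𝓝 (q + 1)) := by
  have h1 := ((hq.add_const 1).add (hd.inv_tendsto_atTop.const_mul (σ ^ 2)))
  rw [mul_zero, add_zero] at h1
  refine h1.congr' ?_
  filter_upwards [eventually_gt_atTop 0, hd.eventually_gt_atTop 0] with n hn hDn
  have hn' : (n : ℝ) ≠ 0 := by positivity
  have hD : boundedNorm mu s₁ s₂ n ≠ 0 := fun h0 => by simp [h0] at hDn
  simp only [scoreVariance, Pi.inv_apply]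
  field_simp

theorem isLittleO_rate_boundedNorm
    (hd : Tendsto (fun n : ℕ => boundedNorm mu s₁ s₂ n ^ 2 / n) atTop atTop) :
    (fun n : ℕ => (n : ℝ) / boundedNorm mu s₁ s₂ n) =o[atTop] fun n : ℕ => √(n : ℝ) := by
  refine isLittleO_sqrt_of_sq_div (hd.inv_tendsto_atTop.congr fun n => ?_)
  rcases eq_or_ne (n : ℝ) 0 with h | h
  · simp [h]
  · simp only [Pi.inv_apply, inv_div, div_pow]
    field_simp

theorem tendsto_rate_large (hl : ∀ n, 0 < lam n) (hs : Tendsto s₁ atTop atTop)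
    (ha : Tendsto (fun n : ℕ => lam n ^ 2 * s₁ n / n) atTop atTop) {q : ℝ}
    (hq : Tendsto (fun n : ℕ => boundedNorm mu s₁ s₂ n ^ 2 / (lam n ^ 2 * s₁ n)) atTop (𝓝 q)) :
    Tendsto (fun n : ℕ => ((n : ℝ) / (lam n * √(s₁ n : ℝ)) / n) ^ 2 *
      scoreVariance mu s₁ s₂ lam σ n) atTop (𝓝 (1 + q)) := by
  have h1 := ((hq.const_add 1).add (ha.inv_tendsto_atTop.const_mul (σ ^ 2)))
  rw [mul_zero, add_zero] at h1
  refine h1.congr' ?_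
  filter_upwards [eventually_gt_atTop 0, hs.eventually_gt_atTop 0] with n hn hsn
  have hn' : (n : ℝ) ≠ 0 := by positivity
  have hs' : (s₁ n : ℝ) ≠ 0 := by positivity
  have hl' := (hl n).ne'
  simp only [scoreVariance, Pi.inv_apply, div_pow, mul_pow, Real.sq_sqrt (Nat.cast_nonneg (s₁ n))]
  field_simp

theorem isLittleO_rate_large
    (ha : Tendsto (fun n : ℕ => lam n ^ 2 * s₁ n / n) atTop atTop) :
    (fun n : ℕ => (n : ℝ) / (lam n * √(s₁ n : ℝ))) =o[atTop] fun n : ℕ => √(n : ℝ) := by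
  refine isLittleO_sqrt_of_sq_div (ha.inv_tendsto_atTop.congr fun n => ?_)
  rcases eq_or_ne (n : ℝ) 0 with h | h
  · simp [h]
  · simp only [Pi.inv_apply, inv_div, div_pow, mul_pow, Real.sq_sqrt (Nat.cast_nonneg (s₁ n))]
    field_simp

theorem tendsto_signal_of_isLittleO (hl : ∀ n, 0 < lam n)
    (h : (fun n : ℕ => (s₁ n : ℝ)) =o[atTop] fun n : ℕ => (n : ℝ) / lam n ^ 2) :
    Tendsto (fun n : ℕ => lam n ^ 2 * s₁ n / n) atTop (𝓝 0) := by
  refine h.tendsto_div_nhds_zero.congr fun n => ?_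
  have hl' := (hl n).ne'
  rw [div_div_eq_mul_div, mul_comm]

theorem tendsto_signal_of_isEquivalent (hl : ∀ n, 0 < lam n) {b : ℝ} (hb : 0 < b)
    (h : (fun n : ℕ => (s₁ n : ℝ)) ~[atTop] fun n : ℕ => b * n / lam n ^ 2) :
    Tendsto (fun n : ℕ => lam n ^ 2 * s₁ n / n) atTop (𝓝 b) := by
  have h1 := (isEquivalent_iff_tendsto_one (by
    filter_upwards [eventually_gt_atTop 0] with n hn
    have := hl n
    positivity)).1 h
  have h2 := h1.const_mul b
  rw [mul_one] at h2
  refine h2.congr' ?_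
  filter_upwards [eventually_gt_atTop 0] with n hn
  have hl' := (hl n).ne'
  have hn' : (n : ℝ) ≠ 0 := by positivity
  simp only [Pi.div_apply]
  field_simp

theorem tendsto_signal_atTop (hl : ∀ n, 0 < lam n)
    (hs : Tendsto s₁ atTop atTop)
    (h : (fun n : ℕ => (n : ℝ) / lam n ^ 2) =o[atTop] fun n : ℕ => (s₁ n : ℝ)) :
    Tendsto (fun n : ℕ => lam n ^ 2 * s₁ n / n) atTop atTop := by
  have h1 : Tendsto (fun n : ℕ => (n : ℝ) / lam n ^ 2 / s₁ n) atTop (𝓝[>] 0) := by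
    refine tendsto_nhdsWithin_iff.2 ⟨h.tendsto_div_nhds_zero, ?_⟩
    filter_upwards [eventually_gt_atTop 0, hs.eventually_gt_atTop 0] with n hn hsn
    have := hl n
    simp only [Set.mem_Ioi]
    positivity
  refine h1.inv_tendsto_nhdsGT_zero.congr fun n => ?_
  simp only [Pi.inv_apply, inv_div]
  rw [div_div_eq_mul_div, mul_comm]

/-- Because `|min f g - g| ≤ |f - g|`. -/
theorem isEquivalent_min_right {f g : ℕ → ℝ} (h : f ~[atTop] g) :
    (fun n => min (f n) (g n)) ~[atTop] g := by
  refine IsBigO.trans_isLittleO (IsBigO.of_bound 1 (Eventually.of_forall fun n => ?_)) h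
  simp only [Pi.sub_apply, Real.norm_eq_abs, one_mul]
  rcases le_total (f n) (g n) with h1 | h1
  · rw [min_eq_left h1]
  · rw [min_eq_right h1, sub_self, abs_zero]
    exact abs_nonneg _

theorem eventually_le_of_isLittleO {f g : ℕ → ℝ} (hf : ∀ n, 0 ≤ f n) (hg : ∀ n, 0 ≤ g n)
    (h : f =o[atTop] g) : ∀ᶠ n in atTop, f n ≤ g n := by
  filter_upwards [h.def one_pos] with n hn
  rwa [one_mul, Real.norm_of_nonneg (hf n), Real.norm_of_nonneg (hg n)] at hn

/-- Converts a comparison of the two candidate rates in the last regime into one of the variance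
terms `lam² s₁` and `D²`; this is where `b` enters the limit. -/
theorem rate_ratio_sq {b : ℝ} (hb : 0 < b) {l D : ℝ} {s n : ℕ} (hn : 0 < n) :
    ((n : ℝ) / D / (√b * n / (l * √(s : ℝ)))) ^ 2 * b = l ^ 2 * s / D ^ 2 := by
  have hn' : (n : ℝ) ≠ 0 := by positivity
  simp only [div_pow, mul_pow, Real.sq_sqrt hb.le, Real.sq_sqrt (Nat.cast_nonneg (α := ℝ) s)]
  rcases eq_or_ne D 0 with h | h
  · simp [h]
  · field_simp

end Rates

end IncidentalRegression

/-! ### The eight regimes -/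

open IncidentalRegression in
theorem theorem3p6 {Ω : Type*} [MeasurableSpace Ω] (P : Measure Ω) [IsProbabilityMeasure P]
    {d : ℕ} (X : ℕ → Ω → Vec d) (ε : ℕ → Ω → ℝ) (σ : ℝ)
    (mu : ℕ → ℕ → ℝ) (s₁ s₂ : ℕ → ℕ) (κ γ lam : ℕ → ℝ)
    (βstar : Vec d) (βhat : ℕ → Ω → Vec d)
    (h_design : RandomDesign P X ε σ)
    (h_max : MaximalBounds P X ε κ γ)
    (h_sparse : SparseIncidental mu s₁ s₂ κ γ)
    (h_lam : RegularizationSpec mu s₁ κ γ lam)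
    (h_est : IsOneStepEstimator P X ε mu βstar lam βhat)
    (h_moment : MomentAssumption P X mu s₁ s₂)
    (D : ℕ → ℝ) (hD : D = boundedNorm mu s₁ s₂)
    (S : Matrix (Fin d) (Fin d) ℝ) (hS : S = covMatrix P (X 0))
    (b c : ℝ) (hb : 0 < b) (hc : 0 < c) :
    -- (1)
    ((fun n : ℕ => (s₁ n : ℝ)) =o[atTop] (fun n : ℕ => (n : ℝ) / lam n ^ 2) →
      (fun n : ℕ => D n ^ 2 / n) =o[atTop] (fun _ : ℕ => (1 : ℝ)) →
      ScaledErrorTendsto P (fun n => √(n : ℝ)) βhat βstar (σ ^ 2 • S⁻¹)) ∧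
    -- (2)
    ((fun n : ℕ => (s₁ n : ℝ)) =o[atTop] (fun n : ℕ => (n : ℝ) / lam n ^ 2) →
      (fun n : ℕ => D n ^ 2 / n) ~[atTop] (fun _ : ℕ => c) →
      ScaledErrorTendsto P (fun n => √(n : ℝ)) βhat βstar ((c + σ ^ 2) • S⁻¹)) ∧
    -- (3)
    ((fun n : ℕ => (s₁ n : ℝ)) =o[atTop] (fun n : ℕ => (n : ℝ) / lam n ^ 2) →
      Tendsto (fun n : ℕ => D n ^ 2 / n) atTop atTop →
      ∀ r : ℕ → ℝ, r ~[atTop] (fun n : ℕ => (n : ℝ) / D n) →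
        r =o[atTop] (fun n : ℕ => √(n : ℝ)) ∧ ScaledErrorTendsto P r βhat βstar S⁻¹) ∧
    -- (4)
    ((fun n : ℕ => (s₁ n : ℝ)) ~[atTop] (fun n : ℕ => b * n / lam n ^ 2) →
      (fun n : ℕ => D n ^ 2 / n) =o[atTop] (fun _ : ℕ => (1 : ℝ)) →
      ScaledErrorTendsto P (fun n => √(n : ℝ)) βhat βstar ((b + σ ^ 2) • S⁻¹)) ∧
    -- (5)
    ((fun n : ℕ => (s₁ n : ℝ)) ~[atTop] (fun n : ℕ => b * n / lam n ^ 2) →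
      (fun n : ℕ => D n ^ 2 / n) ~[atTop] (fun _ : ℕ => c) →
      ScaledErrorTendsto P (fun n => √(n : ℝ)) βhat βstar ((b + c + σ ^ 2) • S⁻¹)) ∧
    -- (6)
    ((fun n : ℕ => (s₁ n : ℝ)) ~[atTop] (fun n : ℕ => b * n / lam n ^ 2) →
      Tendsto (fun n : ℕ => D n ^ 2 / n) atTop atTop →
      ∀ r : ℕ → ℝ, r ~[atTop] (fun n : ℕ => (n : ℝ) / D n) →
        r =o[atTop] (fun n : ℕ => √(n : ℝ)) ∧ ScaledErrorTendsto P r βhat βstar S⁻¹) ∧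
    -- (7), two alternatives for `D`
    ((fun n : ℕ => (n : ℝ) / lam n ^ 2) =o[atTop] (fun n : ℕ => (s₁ n : ℝ)) →
      ((fun n : ℕ => D n ^ 2 / n) =o[atTop] (fun _ : ℕ => (1 : ℝ)) ∨
        (fun n : ℕ => D n ^ 2 / n) ~[atTop] (fun _ : ℕ => c)) →
      ∀ r : ℕ → ℝ, r ~[atTop] (fun n : ℕ => (n : ℝ) / (lam n * √(s₁ n : ℝ))) →
        r =o[atTop] (fun n : ℕ => √(n : ℝ)) ∧ ScaledErrorTendsto P r βhat βstar S⁻¹) ∧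
    -- (8)
    ((fun n : ℕ => (n : ℝ) / lam n ^ 2) =o[atTop] (fun n : ℕ => (s₁ n : ℝ)) →
      Tendsto (fun n : ℕ => D n ^ 2 / n) atTop atTop →
      ∀ r : ℕ → ℝ,
        r ~[atTop] (fun n : ℕ => min (√b * n / (lam n * √(s₁ n : ℝ))) ((n : ℝ) / D n)) →
        r =o[atTop] (fun n : ℕ => √(n : ℝ)) ∧
        -- (8a)
        ((fun n : ℕ => (n : ℝ) / D n) =o[atTop]
            (fun n : ℕ => √b * n / (lam n * √(s₁ n : ℝ))) →
          ScaledErrorTendsto P r βhat βstar S⁻¹) ∧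
        -- (8b)
        ((fun n : ℕ => √b * n / (lam n * √(s₁ n : ℝ))) ~[atTop]
            (fun n : ℕ => (n : ℝ) / D n) →
          ScaledErrorTendsto P r βhat βstar ((1 + b) • S⁻¹)) ∧
        -- (8c)
        ((fun n : ℕ => √b * n / (lam n * √(s₁ n : ℝ))) =o[atTop]
            (fun n : ℕ => (n : ℝ) / D n) →
          ScaledErrorTendsto P r βhat βstar (b • S⁻¹))) := by
  subst hS hD
  have hlam := h_lam.lam_pos h_max.γ_pos
  have hD0 : ∀ n, 0 ≤ boundedNorm mu s₁ s₂ n := fun n => Real.sqrt_nonneg _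
  have main : ∀ (r : ℕ → ℝ) (τ : ℝ), 0 ≤ τ → r =O[atTop] (fun n : ℕ => √(n : ℝ)) →
      Tendsto (fun n : ℕ => (r n / n) ^ 2 * scoreVariance mu s₁ s₂ lam σ n) atTop (𝓝 τ) →
      ScaledErrorTendsto P r βhat βstar (τ • (covMatrix P (X 0))⁻¹) := fun r τ hτ0 hr hτ =>
    scaledErrorTendsto_of_rate h_design h_max h_sparse h_lam h_est hr hτ0 hτ
  have hsqrt : ∀ p q : ℝ, 0 ≤ p → 0 ≤ q →
      Tendsto (fun n : ℕ => lam n ^ 2 * s₁ n / n) atTop (𝓝 p) →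
      Tendsto (fun n : ℕ => boundedNorm mu s₁ s₂ n ^ 2 / n) atTop (𝓝 q) →
      ScaledErrorTendsto P (fun n => √(n : ℝ)) βhat βstar
        ((p + q + σ ^ 2) • (covMatrix P (X 0))⁻¹) := fun p q hp hq h1 h2 =>
    main _ _ (by positivity) (isBigO_refl _ _) (tendsto_rate_sqrt h1 h2)
  have hbounded : ∀ p : ℝ, Tendsto (fun n : ℕ => lam n ^ 2 * s₁ n / n) atTop (𝓝 p) →
      Tendsto (fun n : ℕ => boundedNorm mu s₁ s₂ n ^ 2 / n) atTop atTop →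
      ∀ r : ℕ → ℝ, r ~[atTop] (fun n : ℕ => (n : ℝ) / boundedNorm mu s₁ s₂ n) →
        r =o[atTop] (fun n : ℕ => √(n : ℝ)) ∧
          ScaledErrorTendsto P r βhat βstar (covMatrix P (X 0))⁻¹ := fun p h1 h2 r hr => by
    have hro := hr.trans_isLittleO (isLittleO_rate_boundedNorm h2)
    refine ⟨hro, ?_⟩
    have hq : Tendsto (fun n : ℕ => lam n ^ 2 * s₁ n / boundedNorm mu s₁ s₂ n ^ 2) atTop
        (𝓝 0) := by
      refine (h1.div_atTop h2).congr' ?_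
      filter_upwards [eventually_gt_atTop 0] with n hn
      have hn' : (n : ℝ) ≠ 0 := by positivity
      rw [div_div_div_cancel_right₀ hn']
    have := main r _ (by norm_num) hro.isBigO
      (tendsto_rate_congr hr (tendsto_rate_boundedNorm h2 hq))
    rwa [zero_add, one_smul] at this
  have hd0 : (fun n : ℕ => boundedNorm mu s₁ s₂ n ^ 2 / n) =o[atTop] (fun _ : ℕ => (1 : ℝ)) →
      Tendsto (fun n : ℕ => boundedNorm mu s₁ s₂ n ^ 2 / n) atTop (𝓝 0) :=
    fun h => (isLittleO_one_iff ℝ).1 h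
  have hdc : (fun n : ℕ => boundedNorm mu s₁ s₂ n ^ 2 / n) ~[atTop] (fun _ : ℕ => c) →
      Tendsto (fun n : ℕ => boundedNorm mu s₁ s₂ n ^ 2 / n) atTop (𝓝 c) :=
    fun h => (isEquivalent_const_iff_tendsto hc.ne').1 h
  refine ⟨fun h1 h2 => ?_, fun h1 h2 => ?_, fun h1 h2 => ?_, fun h1 h2 => ?_, fun h1 h2 => ?_,
    fun h1 h2 => ?_, fun h1 h2 r hr => ?_, fun h1 h2 r hr => ?_⟩
  · simpa using hsqrt 0 0 le_rfl le_rfl (tendsto_signal_of_isLittleO hlam h1) (hd0 h2)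
  · simpa using hsqrt 0 c le_rfl hc.le (tendsto_signal_of_isLittleO hlam h1) (hdc h2)
  · exact hbounded 0 (tendsto_signal_of_isLittleO hlam h1) h2
  · simpa using hsqrt b 0 hb.le le_rfl (tendsto_signal_of_isEquivalent hlam hb h1) (hd0 h2)
  · exact hsqrt b c hb.le hc.le (tendsto_signal_of_isEquivalent hlam hb h1) (hdc h2)
  · exact hbounded b (tendsto_signal_of_isEquivalent hlam hb h1) h2
  · have ha := tendsto_signal_atTop hlam h_sparse.s₁_tendsto h1
    obtain ⟨q, hd⟩ : ∃ q, Tendsto (fun n : ℕ => boundedNorm mu s₁ s₂ n ^ 2 / n) atTop (𝓝 q) :=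
      h2.elim (fun h => ⟨0, hd0 h⟩) fun h => ⟨c, hdc h⟩
    have hro := hr.trans_isLittleO (isLittleO_rate_large ha)
    refine ⟨hro, ?_⟩
    have hq : Tendsto (fun n : ℕ => boundedNorm mu s₁ s₂ n ^ 2 / (lam n ^ 2 * s₁ n)) atTop
        (𝓝 0) := by
      refine (hd.div_atTop ha).congr' ?_
      filter_upwards [eventually_gt_atTop 0] with n hn
      have hn' : (n : ℝ) ≠ 0 := by positivity
      rw [div_div_div_cancel_right₀ hn']
    have := main r _ (by norm_num) hro.isBigO
      (tendsto_rate_congr hr (tendsto_rate_large hlam h_sparse.s₁_tendsto ha hq))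
    rwa [add_zero, one_smul] at this
  · have ha := tendsto_signal_atTop hlam h_sparse.s₁_tendsto h1
    set f : ℕ → ℝ := fun n => √b * n / (lam n * √(s₁ n : ℝ)) with hf
    set g : ℕ → ℝ := fun n => (n : ℝ) / boundedNorm mu s₁ s₂ n with hg
    have hf0 : ∀ n, 0 ≤ f n := fun n => by
      have := hlam n
      positivity
    have hg0 : ∀ n, 0 ≤ g n := fun n => div_nonneg (Nat.cast_nonneg n) (hD0 n)
    have hgo := isLittleO_rate_boundedNorm h2
    have hro : r =o[atTop] (fun n : ℕ => √(n : ℝ)) := by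
      refine hr.trans_isLittleO (IsBigO.trans_isLittleO (IsBigO.of_bound 1
        (Eventually.of_forall fun n => ?_)) hgo)
      rw [one_mul, Real.norm_of_nonneg (le_min (hf0 n) (hg0 n)), Real.norm_of_nonneg (hg0 n)]
      exact min_le_right _ _
    have hratio : ∀ q : ℝ, Tendsto (fun n => g n / f n) atTop (𝓝 q) →
        Tendsto (fun n : ℕ => lam n ^ 2 * s₁ n / boundedNorm mu s₁ s₂ n ^ 2) atTop
          (𝓝 (q ^ 2 * b)) := fun q hq => by
      refine ((hq.pow 2).mul_const b).congr' ?_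
      filter_upwards [eventually_gt_atTop 0] with n hn
      exact rate_ratio_sq hb hn
    refine ⟨hro, fun h3 => ?_, fun h3 => ?_, fun h3 => ?_⟩
    · have hrg : r ~[atTop] g := by
        refine hr.congr_right ?_
        filter_upwards [eventually_le_of_isLittleO hg0 hf0 h3] with n hn
        exact min_eq_right hn
      have := main r _ (by norm_num) hro.isBigO (tendsto_rate_congr hrg
        (tendsto_rate_boundedNorm h2 (hratio 0 h3.tendsto_div_nhds_zero)))
      simpa using this
    -- The rates agree asymptotically, so `n / D` is used as reference; ratio one means `lam² s₁ /
    -- D² → b`, giving total variance `b + 1`.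
    · have hrg : r ~[atTop] g := hr.trans (isEquivalent_min_right h3)
      have hfne : ∀ᶠ n in atTop, f n ≠ 0 := by
        filter_upwards [eventually_gt_atTop 0, h_sparse.s₁_tendsto.eventually_gt_atTop 0]
          with n hn hsn
        have := hlam n
        positivity
      have hone : Tendsto (fun n => g n / f n) atTop (𝓝 1) :=
        (isEquivalent_iff_tendsto_one hfne).1 h3.symm
      have := main r _ (by positivity) hro.isBigO (tendsto_rate_congr hrg
        (tendsto_rate_boundedNorm h2 (hratio 1 hone)))
      simpa [add_comm] using this
    · have hrf : r ~[atTop] f := by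
        refine hr.congr_right ?_
        filter_upwards [eventually_le_of_isLittleO hf0 hg0 h3] with n hn
        exact min_eq_left hn
      have hq : Tendsto (fun n : ℕ => boundedNorm mu s₁ s₂ n ^ 2 / (lam n ^ 2 * s₁ n)) atTop
          (𝓝 0) := by
        have h4 := (h3.tendsto_div_nhds_zero.pow 2).div_const b
        rw [zero_pow two_ne_zero, zero_div] at h4
        refine h4.congr' ?_
        filter_upwards [eventually_gt_atTop 0] with n hn
        rw [← inv_div (lam n ^ 2 * (s₁ n : ℝ)), ← rate_ratio_sq hb hn, mul_inv, ← inv_pow, inv_div,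
          div_eq_mul_inv]
      -- The rate `n / (lam √s₁)` has limiting variance one; the extra factor `√b` in the rate
      -- multiplies it by `b`.
      have h5 := (tendsto_rate_large (σ := σ) hlam h_sparse.s₁_tendsto ha hq).const_mul b
      have := main r _ (by linarith) hro.isBigO (tendsto_rate_congr hrf (h5.congr fun n => by
        simp only [hf]
        rw [← mul_assoc, mul_div_assoc √b, mul_div_assoc √b, mul_pow √b, Real.sq_sqrt hb.le]))
      simpa using this
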